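/- Let $3\le n\le 9$ and view $\mathbb S^n$ as the unit sphere of $\mathbb C\oplus\mathbb R^{n-1}$. For $h,C\in\mathbb R$ and $s\in(0,\pi/2)$ put $L(s)=\cos s\,\sin^{n-2}s$ and $R(s)=C+\frac{h}{n-1}\sin^{n-1}s$, let $J(C,h)$ be the interval $\{s\in(0,\pi/2): |R(s)|<L(s)\}$, and let $$\dot s_1(s)=\frac{R(s)}{\cos s\,\sqrt{\cos^2 s\,\sin^{2(n-2)}s-R(s)^2}},\qquad W(h,C)=2\int_{J(C,h)}\dot s_1(s)\,ds .$$ Let $s_h\in(0,\pi/2)$ be given by $\cot s_h=\frac{h+\sqrt{h^2+4(n-2)}}{2(n-2)}$, let $C_h=L(s_h)-\frac{h}{n-1}\sin^{n-1}s_h$, and for integers $k>2$ let $$Z(k)=\Big(\tfrac{k(n-1)}{\pi},\ (k^2-2)\sqrt{\tfrac{n-2}{k^2-1}}\Big).$$ **Theorem.** There are infinitely many integers $k>2$ for which $Z(k)$ is nonempty. For every integer $k>2$ and every $h\in Z(k)$ there is a $C\in(0,C_h)$ such that $\dot s_1$ is integrable on $J(C,h)$ and $$W(h,C)=\frac{2\pi}{k},$$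 and there is a smooth function $\sigma:\mathbb R\to\mathbb R$ with the following properties. (i) $\sigma$ is even and $W(h,C)$-periodic, it increases strictly on $[0,\frac12W(h,C)]$ from $\inf J(C,h)$ to $\sup J(C,h)$, and for $\theta\in(0,\frac12W(h,C))$ one has $\sigma(\theta)\in J(C,h)$ and $\sigma'(\theta)=1/\dot s_1(\sigma(\theta))$. Thus $\theta\mapsto(\cos\sigma(\theta)\,e^{i\theta},\sin\sigma(\theta))$ is the Delaunay generating curve with parameters $h$ and $C$, continued by reflections in the phase $\theta$, and it closes up after one turn, consisting of $k$ periods of oscillation. (ii) The map $(e^{i\theta},x)\mapsto(\cos\sigma(\theta)\,e^{i\theta},\ \sin\sigma(\theta)\,x)$ is well defined and is a topological embedding of $S^1\times S^{n-2}$ into $\mathbb C\oplus\mathbb R^{n-1}$, and its image, the Delaunay hypersurface generated by this curve, is a smoothly embedded hypersurface of $\mathbb S^n$ which has constant mean curvature $h$ (the unnormalized trace of the second fundamental form) with respect to a continuous unit normal field. -/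

import Mathlib

open Set MeasureTheory
open scoped ContDiff

/-! ### Mean curvature of embedded hypersurfaces of the unit sphere -/

section Hypersurface

variable {E : Type*} [NormedAddCommGroup E] [InnerProductSpace ℝ E] {m : ℕ}

/-- `φ : U → S` is a smooth regular local parametrization of the subset `S`: an injective smooth
immersion which is a homeomorphism onto a relatively open subset of `S`. -/
structure IsLocalParametrization (S : Set E) (U : Set (EuclideanSpace ℝ (Fin m)))
    (φ : EuclideanSpace ℝ (Fin m) → E) : Prop where
  isOpen : IsOpen U
  contDiffOn : ContDiffOn ℝ ∞ φ U
  injOn : InjOn φ U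
  immersion : ∀ u ∈ U, Function.Injective (fderiv ℝ φ u)
  openImage : ∀ V ⊆ U, IsOpen V → ∃ O : Set E, IsOpen O ∧ φ '' V = S ∩ O

/-- The first fundamental form `⟨∂ᵢφ, ∂ⱼφ⟩` at `u`. -/
noncomputable def firstFundamentalForm (φ : EuclideanSpace ℝ (Fin m) → E)
    (u : EuclideanSpace ℝ (Fin m)) : Matrix (Fin m) (Fin m) ℝ :=
  Matrix.of fun i j =>
    inner ℝ (fderiv ℝ φ u (EuclideanSpace.single i 1)) (fderiv ℝ φ u (EuclideanSpace.single j 1))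

/-- The second fundamental form `⟨∂ᵢ∂ⱼφ, ν⟩` at `u` in the normal direction `ν`. When `φ` takes
values in the unit sphere and `ν` is tangent to the sphere at `φ u`, this is also the second
fundamental form inside the sphere. -/
noncomputable def secondFundamentalForm (φ : EuclideanSpace ℝ (Fin m) → E) (ν : E)
    (u : EuclideanSpace ℝ (Fin m)) : Matrix (Fin m) (Fin m) ℝ :=
  Matrix.of fun i j =>
    inner ℝ (fderiv ℝ (fderiv ℝ φ) u (EuclideanSpace.single i 1) (EuclideanSpace.single j 1)) ν

/-- The (unnormalized) mean curvature: the trace of the second fundamental form with respect to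
the induced metric. -/
noncomputable def meanCurvature (φ : EuclideanSpace ℝ (Fin m) → E) (ν : E)
    (u : EuclideanSpace ℝ (Fin m)) : ℝ :=
  ((firstFundamentalForm φ u)⁻¹ * secondFundamentalForm φ ν u).trace

/-- `S` is an embedded smooth `m`-dimensional submanifold of the unit sphere of `E` that has
constant mean curvature `h` with respect to some continuous unit normal field `ν` (normal to `S`
and tangent to the sphere). It is a hypersurface of the sphere when `dim E = m + 2`. -/
def IsEmbeddedCMC (m : ℕ) (h : ℝ) (S : Set E) : Prop :=
  S ⊆ Metric.sphere (0 : E) 1 ∧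
  ∃ ν : E → E, ContinuousOn ν S ∧ ∀ p ∈ S, ‖ν p‖ = 1 ∧ inner ℝ (ν p) p = 0 ∧
    ∃ (U : Set (EuclideanSpace ℝ (Fin m))) (φ : EuclideanSpace ℝ (Fin m) → E),
      IsLocalParametrization S U φ ∧
      ∃ u ∈ U, φ u = p ∧ (∀ w, inner ℝ (fderiv ℝ φ u w) (ν p) = 0) ∧ meanCurvature φ (ν p) u = h

end Hypersurface

/-! ### Delaunay hypersurfaces in the unit sphere of `ℂ ⊕ ℝⁿ⁻¹` -/

namespace Delaunay

/-- `ℂ ⊕ ℝⁿ⁻¹` with the Euclidean norm; its unit sphere is `𝕊ⁿ`. -/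
abbrev Ambient (n : ℕ) : Type := WithLp 2 (ℂ × EuclideanSpace ℝ (Fin (n - 1)))

/-- `R(s) = C + h / (n - 1) * sin ^ (n - 1) s`. -/
noncomputable def R (n : ℕ) (h C s : ℝ) : ℝ := C + h / ((n : ℝ) - 1) * Real.sin s ^ (n - 1)

/-- `L(s) = cos s * sin ^ (n - 2) s`. -/
noncomputable def L (n : ℕ) (s : ℝ) : ℝ := Real.cos s * Real.sin s ^ (n - 2)

/-- The interval `J(C, h)` of those `s ∈ (0, π / 2)` for which `L ^ 2 - R ^ 2` is positive. For
`h, C ≥ 0` this is where the graph of `L` lies above that of `R`. -/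
def J (n : ℕ) (h C : ℝ) : Set ℝ := {s | s ∈ Ioo 0 (Real.pi / 2) ∧ |R n h C s| < L n s}

/-- The derivative `ds₁/ds` of the phase `s₁` of the generating curve
`s ↦ (cos s * exp (i s₁(s)), sin s)`. -/
noncomputable def phaseDeriv (n : ℕ) (h C s : ℝ) : ℝ :=
  R n h C s /
    (Real.cos s * √(Real.cos s ^ 2 * Real.sin s ^ (2 * (n - 2)) - R n h C s ^ 2))

/-- The width `W(h, C)` of one period. -/
noncomputable def W (n : ℕ) (h C : ℝ) : ℝ := 2 * ∫ s in J n h C, phaseDeriv n h C s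

/-- The point `s_h ∈ (0, π / 2)` with `-tan s_h + (n - 2) cot s_h = h`, that is with
`cot s_h = (h + √(h² + 4 (n - 2))) / (2 (n - 2))`. -/
noncomputable def contactPoint (n : ℕ) (h : ℝ) : ℝ :=
  Real.arctan (2 * ((n : ℝ) - 2) / (h + √(h ^ 2 + 4 * ((n : ℝ) - 2))))

/-- The constant `C_h` for which the graphs of `L` and `R` touch (at `s_h`). -/
noncomputable def contactConstant (n : ℕ) (h : ℝ) : ℝ :=
  L n (contactPoint n h) - h / ((n : ℝ) - 1) * Real.sin (contactPoint n h) ^ (n - 1)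

/-- The singly spiral product `(t, x) ↦ (a(t) e^{i s₁(t)}, b(t) x)` of the curve
`γ = (a e^{i s₁}, b)` in `𝕊² ⊆ ℂ ⊕ ℝ` with the unit sphere of `ℝⁿ⁻¹`. -/
noncomputable def spiralProduct {n : ℕ} (γ : ℝ → ℂ × ℝ) (t : ℝ)
    (x : EuclideanSpace ℝ (Fin (n - 1))) : Ambient n :=
  WithLp.toLp 2 ((γ t).1, (γ t).2 • x)

/-- The curve `θ ↦ (cos σ(θ) e^{iθ}, sin σ(θ))` in `𝕊²`, with the phase as parameter. -/
noncomputable def phaseCurve (σ : ℝ → ℝ) (θ : ℝ) : ℂ × ℝ :=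
  (Real.cos (σ θ) * Complex.exp (θ * Complex.I), Real.sin (σ θ))

/-- The rotational hypersurface generated by the curve with profile `σ`. -/
def hypersurface (n : ℕ) (σ : ℝ → ℝ) : Set (Ambient n) :=
  {p | ∃ (θ : ℝ) (x : EuclideanSpace ℝ (Fin (n - 1))),
    ‖x‖ = 1 ∧ spiralProduct (phaseCurve σ) θ x = p}

/-- `σ` is the global oscillating profile with parameters `h` and `C` (written as a function of
the phase `θ = s₁`): on the half period `(0, W / 2)` the phase is recovered from `s = σ(θ)` by
`dθ/ds = phaseDeriv`, with `σ` running through `J(C, h)` from its left to its right end, and the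
curve is continued by reflection in the phase, one full period having width `W(h, C)`. -/
structure IsOscillatingProfile (n : ℕ) (h C : ℝ) (σ : ℝ → ℝ) : Prop where
  contDiff : ContDiff ℝ ∞ σ
  left_end : σ 0 = sInf (J n h C)
  right_end : σ (W n h C / 2) = sSup (J n h C)
  strictMonoOn : StrictMonoOn σ (Icc 0 (W n h C / 2))
  mapsTo : MapsTo σ (Ioo 0 (W n h C / 2)) (J n h C)
  hasDerivAt : ∀ θ ∈ Ioo 0 (W n h C / 2), HasDerivAt σ (phaseDeriv n h C (σ θ))⁻¹ θ
  even : Function.Even σ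
  periodic : Function.Periodic σ (W n h C)

/-- The open interval `Z(k)`. -/
noncomputable def Z (n : ℕ) (k : ℤ) : Set ℝ :=
  Ioo ((k : ℝ) * ((n : ℝ) - 1) / Real.pi)
    (((k : ℝ) ^ 2 - 2) * √(((n : ℝ) - 2) / ((k : ℝ) ^ 2 - 1)))

end Delaunay

/-! ### Square-root coordinates at a nondegenerate maximum -/

section MorseCoordinate

open Filter Topology

/-! Since L - R = `gap` - C with `gap` independent of C, and `gap` rises strictly to its maximum C_h
at s_h and then falls, there is a smooth increasing coordinate y with `gap` = C_h - y²
(`exists_morse_coordinate`). Every h in Z(k) is positive, so R > 0 when C > 0, and J(C, h) is the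
sublevel set |y| < ε with ε² = C_h - C. The phase derivative is a smooth positive weight divided by
√(ε² - y²). The substitution y = -ε cos φ removes the singularities at the ends of J: half the width
is the integral over [0, π] of weight / y', which is continuous in C on (0, C_h], the endpoint C_h
included.

The width is then found by the intermediate value theorem (`exists_width_eq`). At C = C_h the
integrand is constant and the half width is π / √(1 + (n-2) cot² s_h); this exceeds π/k when h is
below the right end of Z(k). For small C the half width gets below any number larger than (n-1)/h
(`exists_halfWidth_lt`), and (n-1)/h < π/k says that h is above the left end. So some C in between
gives exactly π/k. That Z(k) is nonempty for large k is the inequality (n-1)/π < √(n-2), true for 3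
≤ n ≤ 9.

The same substitution gives the global profile. The phase θ is the primitive of the positive, even,
2π-periodic function weight / y' of φ; its inverse Φ is smooth, and σ(θ) = S(-ε cos Φ(θ)), with S
the inverse of y, is smooth through the turning points (`exists_oscillation`). A width of 2π/k makes
σ 2π-periodic.

For the geometry, ρ = R/L is the cosine of the angle between the generating curve and the parallels.
From R' = hL follows a first order equation for ρ in s, which is the mean curvature equation of the
rotational hypersurface. The companion equation for the other component p of the unit normal holds
first away from the turning points and then everywhere by continuity (`hasDerivAt_tilt`). Rotational
charts in polar coordinates turn these equations into constant mean curvature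
(`meanCurvature_rotChart`), and embeddedness follows because the curve is a graph over the phase
circle with cos σ and sin σ positive. -/

theorem analyticAt_dslope {f : ℝ → ℝ} (hf : ∀ x, AnalyticAt ℝ f x) (c x : ℝ) :
    AnalyticAt ℝ (dslope f c) x := by
  rcases eq_or_ne x c with rfl | hx
  · obtain ⟨p, hp⟩ := hf x
    exact hp.has_fpower_series_dslope_fslope.analyticAt
  · refine AnalyticAt.congr ?_ (dslope_eventuallyEq_slope_of_ne f hx).symm
    have h : AnalyticAt ℝ (fun z => (z - c)⁻¹ • (f z - f c)) x :=
      ((analyticAt_id.sub analyticAt_const).inv (sub_ne_zero.2 hx)).smul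
        ((hf x).sub analyticAt_const)
    exact h

/-- A one-dimensional Morse lemma on an interval on which `F` is unimodal. -/
theorem exists_morse_coordinate {F : ℝ → ℝ} {a b c : ℝ} (hF : ∀ s, AnalyticAt ℝ F s)
    (hc : c ∈ Ioo a b) (hinc : ∀ s ∈ Ioo a c, 0 < deriv F s)
    (hdec : ∀ s ∈ Ioo c b, deriv F s < 0) (hc1 : deriv F c = 0) (hc2 : deriv (deriv F) c < 0) :
    ∃ y : ℝ → ℝ, ContDiffOn ℝ ∞ y (Ioo a b) ∧ (∀ s ∈ Ioo a b, F s = F c - y s ^ 2) ∧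
      (∀ s ∈ Ioo a b, 0 < deriv y s) ∧ y c = 0 ∧
      deriv y c ^ 2 = -deriv (deriv F) c / 2 := by
  -- M is the second order Taylor quotient of F at c, analytic at c as well. It is negative, by
  -- unimodality away from c and by the second derivative at c, so y = (s - c)√(-M) will do.
  set M := dslope (dslope F c) c with hM
  have hMan : ∀ x, AnalyticAt ℝ M x := analyticAt_dslope (analyticAt_dslope hF c) c
  have hfac : ∀ s, F s = F c + (s - c) ^ 2 * M s := by
    intro s
    have h1 := sub_smul_dslope F c s
    have h2 := sub_smul_dslope (dslope F c) c s
    rw [dslope_same, hc1] at h2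
    simp only [smul_eq_mul, sub_zero] at h1 h2
    rw [pow_two, mul_assoc, h2, h1]; ring
  have hder : ∀ s, HasDerivAt F ((s - c) * (2 * M s + (s - c) * deriv M s)) s := by
    intro s
    have h1 : HasDerivAt (fun s => F c + (s - c) ^ 2 * M s)
        ((s - c) * (2 * M s + (s - c) * deriv M s)) s := by
      have := ((((hasDerivAt_id s).sub_const c).pow 2).mul
        (hMan s).differentiableAt.hasDerivAt).const_add (F c)
      refine this.congr_deriv ?_
      simp; ring
    exact h1.congr_of_eventuallyEq (Eventually.of_forall hfac)
  have hM2 : deriv (deriv F) c = 2 * M c := by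
    have h0 : deriv F = fun s => (s - c) * (2 * M s + (s - c) * deriv M s) :=
      funext fun s => (hder s).deriv
    have hd : DifferentiableAt ℝ (fun s => 2 * M s + (s - c) * deriv M s) c :=
      ((hMan c).differentiableAt.const_mul 2).add
        ((differentiableAt_id.sub_const c).mul (hMan c).deriv.differentiableAt)
    rw [h0]
    have := ((hasDerivAt_id c).sub_const c).mul hd.hasDerivAt
    refine this.deriv.trans ?_
    simp
  have hlt : ∀ s ∈ Ioo a b, s ≠ c → F s < F c := by
    intro s hs hsc
    have hcont : Continuous F := continuous_iff_continuousAt.2 fun x => (hF x).continuousAt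
    rcases lt_or_gt_of_ne hsc with h | h
    · have : StrictMonoOn F (Icc s c) :=
        strictMonoOn_of_deriv_pos (convex_Icc _ _) hcont.continuousOn fun x hx => by
          rw [interior_Icc] at hx; exact hinc x ⟨hs.1.trans hx.1, hx.2⟩
      exact this (left_mem_Icc.2 h.le) (right_mem_Icc.2 h.le) h
    · have : StrictAntiOn F (Icc c s) :=
        strictAntiOn_of_deriv_neg (convex_Icc _ _) hcont.continuousOn fun x hx => by
          rw [interior_Icc] at hx; exact hdec x ⟨hx.1, hx.2.trans hs.2⟩
      exact this (left_mem_Icc.2 h.le) (right_mem_Icc.2 h.le) h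
  have hMneg : ∀ s ∈ Ioo a b, M s < 0 := by
    intro s hs
    rcases eq_or_ne s c with rfl | hsc
    · linarith
    · have h1 := hlt s hs hsc
      rw [hfac s] at h1
      have h2 : 0 < (s - c) ^ 2 := by have := sub_ne_zero.2 hsc; positivity
      by_contra! h3
      nlinarith [mul_nonneg h2.le h3]
  have hsm : ∀ s ∈ Ioo a b, ContDiffAt ℝ ∞ (fun s => √(-M s)) s := fun s hs =>
    ((hMan s).contDiffAt.neg).sqrt (by linarith [hMneg s hs])
  have hyc : ∀ s ∈ Ioo a b, ContDiffAt ℝ ∞ (fun s => (s - c) * √(-M s)) s := fun s hs =>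
    (contDiffAt_id.sub contDiffAt_const).mul (hsm s hs)
  have hsq : ∀ s ∈ Ioo a b, F s = F c - ((s - c) * √(-M s)) ^ 2 := fun s hs => by
    rw [mul_pow, Real.sq_sqrt (by linarith [hMneg s hs]), hfac s]; ring
  have hdc : deriv (fun s => (s - c) * √(-M s)) c = √(-M c) := by
    have := ((hasDerivAt_id c).sub_const c).mul
      ((hsm c hc).differentiableAt (by simp)).hasDerivAt
    refine this.deriv.trans ?_
    simp
  refine ⟨fun s => (s - c) * √(-M s), fun s hs => (hyc s hs).contDiffWithinAt, hsq, ?_, by simp, ?_⟩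
  · intro s hs
    rcases eq_or_ne s c with rfl | hsc
    · rw [hdc]; exact Real.sqrt_pos.2 (by linarith [hMneg s hs])
    · have hd := ((hyc s hs).differentiableAt (by simp)).hasDerivAt
      -- Away from c the sign of y' is read off from F' = -2 y y'.
      have h1 : HasDerivAt F (-(2 * ((s - c) * √(-M s)) *
          deriv (fun s => (s - c) * √(-M s)) s)) s := by
        have h2 := (hd.pow 2).const_sub (F c)
        refine (h2.congr_deriv (by simp)).congr_of_eventuallyEq ?_
        filter_upwards [isOpen_Ioo.mem_nhds hs] with t ht using hsq t ht
      have h3 := h1.deriv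
      have hp : 0 < √(-M s) := Real.sqrt_pos.2 (by linarith [hMneg s hs])
      rcases lt_or_gt_of_ne hsc with h | h
      · have h4 := hinc s ⟨hs.1, h⟩
        rw [h3] at h4
        by_contra! h5
        nlinarith [mul_nonneg (mul_nonneg (by linarith : 0 ≤ c - s) hp.le) (neg_nonneg.2 h5)]
      · have h4 := hdec s ⟨h, hs.2⟩
        rw [h3] at h4
        by_contra! h5
        nlinarith [mul_nonneg (mul_nonneg (by linarith : 0 ≤ s - c) hp.le) (neg_nonneg.2 h5)]
  · rw [hdc, Real.sq_sqrt (by linarith [hMneg c hc]), hM2]; ring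

end MorseCoordinate

/-! ### Smoothness of left inverses -/

section SmoothInverse

open Filter Topology

/-- Smoothness and derivative of a left inverse of a smooth function with positive derivative. -/
theorem contDiffAt_hasDerivAt_leftInverse {f S : ℝ → ℝ} {I : Set ℝ} (hI : IsOpen I)
    (hf : ContDiffOn ℝ ∞ f I) (hd : ∀ x ∈ I, 0 < deriv f x) (hS : ∀ x ∈ I, S (f x) = x)
    {x : ℝ} (hx : x ∈ I) :
    ContDiffAt ℝ ∞ S (f x) ∧ HasDerivAt S (deriv f x)⁻¹ (f x) := by
  have hfx : ContDiffAt ℝ ∞ f x := (hf x hx).contDiffAt (hI.mem_nhds hx)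
  have hne : deriv f x ≠ 0 := (hd x hx).ne'
  have hder : HasDerivAt f (deriv f x) x := (hfx.differentiableAt (by simp)).hasDerivAt
  have hder' : HasFDerivAt f
      ((ContinuousLinearEquiv.unitsEquivAut ℝ (Units.mk0 (deriv f x) hne) : ℝ ≃L[ℝ] ℝ) :
        ℝ →L[ℝ] ℝ) x := by
    refine hder.hasFDerivAt.congr_fderiv ?_
    ext; simp
  set g := hfx.localInverse hder' (by simp)
  have hg : ContDiffAt ℝ ∞ g (f x) := hfx.to_localInverse hder' (by simp)
  have hgx : g (f x) = x := hfx.localInverse_apply_image hder' (by simp)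
  -- S is not assumed continuous; it is identified near f x with the local inverse g through S z = S
  -- (f (g z)) = g z.
  have hev : S =ᶠ[𝓝 (f x)] g := by
    have h1 : ∀ᶠ z in 𝓝 (f x), g z ∈ I :=
      hg.continuousAt.eventually (by rw [hgx]; exact hI.mem_nhds hx)
    have h2 : ∀ᶠ z in 𝓝 (f x), f (g z) = z :=
      (hfx.toOpenPartialHomeomorph f hder' (by simp)).eventually_right_inverse
        (hfx.image_mem_toOpenPartialHomeomorph_target hder' (by simp))
    filter_upwards [h1, h2] with z hz1 hz2
    rw [← hz2, hS _ hz1, hz2]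
  have hSs : ContDiffAt ℝ ∞ S (f x) := hg.congr_of_eventuallyEq hev
  refine ⟨hSs, ?_⟩
  refine HasDerivAt.of_local_left_inverse (f := f) hSs.continuousAt (by rw [hS x hx]; exact hder)
    hne ?_
  have h3 : ∀ᶠ z in 𝓝 (f x), g z ∈ I :=
    hg.continuousAt.eventually (by rw [hgx]; exact hI.mem_nhds hx)
  have h2 : ∀ᶠ z in 𝓝 (f x), f (g z) = z :=
      (hfx.toOpenPartialHomeomorph f hder' (by simp)).eventually_right_inverse
        (hfx.image_mem_toOpenPartialHomeomorph_target hder' (by simp))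
  filter_upwards [h2, hev] with z h2 h4
  rw [h4, h2]

end SmoothInverse

/-! ### Inverting the phase integral -/

section PhaseInverse

open Filter Topology

/-- The inverse of the primitive of a smooth positive even `2π`-periodic function. -/
theorem exists_phase_inverse {ψ : ℝ → ℝ} (hψ : ContDiff ℝ ∞ ψ) (hpos : ∀ x, 0 < ψ x)
    (heven : ∀ x, ψ (-x) = ψ x) (hper : ∀ x, ψ (x + 2 * Real.pi) = ψ x) {T : ℝ}
    (hT : T = 2 * ∫ x in (0 : ℝ)..Real.pi, ψ x) :
    0 < T ∧ ∃ Φ : ℝ → ℝ, ContDiff ℝ ∞ Φ ∧ StrictMono Φ ∧ (∀ x, HasDerivAt Φ (ψ (Φ x))⁻¹ x) ∧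
      Φ 0 = 0 ∧ Φ (T / 2) = Real.pi ∧ (∀ x, Φ (-x) = -Φ x) ∧
      (∀ x, Φ (x + T) = Φ x + 2 * Real.pi) := by
  have hc : Continuous ψ := hψ.continuous
  have hint : ∀ a b, IntervalIntegrable ψ volume a b := fun a b => hc.intervalIntegrable a b
  set θ : ℝ → ℝ := fun φ => ∫ x in (0 : ℝ)..φ, ψ x with hθ
  have hder : ∀ φ, HasDerivAt θ (ψ φ) φ := fun φ =>
    intervalIntegral.integral_hasDerivAt_right (hint _ _)
      hc.stronglyMeasurable.stronglyMeasurableAtFilter hc.continuousAt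
  have hdθ : deriv θ = ψ := funext fun φ => (hder φ).deriv
  have hθs : ContDiff ℝ ∞ θ := by
    rw [contDiff_infty_iff_deriv, hdθ]
    exact ⟨fun x => (hder x).differentiableAt, hψ⟩
  have hmono : StrictMono θ := strictMono_of_deriv_pos fun x => by rw [hdθ]; exact hpos x
  have h0 : θ 0 = 0 := by simp [hθ]
  have hπ : θ Real.pi = T / 2 := by rw [hT]; simp [hθ]
  have hTpos : 0 < T := by
    have := hmono Real.pi_pos
    rw [h0, hπ] at this; linarith
  have hodd : ∀ φ, θ (-φ) = -θ φ := by
    intro φ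
    have h1 : ∫ x in (0 : ℝ)..φ, ψ (-x) = ∫ x in (-φ)..0, ψ x := by
      rw [intervalIntegral.integral_comp_neg, neg_zero]
    simp only [heven] at h1
    simp only [hθ]
    rw [h1, intervalIntegral.integral_symm]
  have h2π : ∫ x in (0 : ℝ)..(2 * Real.pi), ψ x = T := by
    have hp : Function.Periodic ψ (2 * Real.pi) := hper
    have h1 := hp.intervalIntegral_add_eq 0 (-Real.pi)
    rw [zero_add] at h1
    have h2 := intervalIntegral.integral_add_adjacent_intervals (hint (-Real.pi) 0)
      (hint 0 Real.pi)
    have h3 := hodd Real.pi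
    simp only [hθ] at h3 hπ
    rw [intervalIntegral.integral_symm] at h3
    rw [h1, show -Real.pi + 2 * Real.pi = Real.pi by ring, ← h2]
    linarith
  have hshift : ∀ φ, θ (φ + 2 * Real.pi) = θ φ + T := by
    intro φ
    have hp : Function.Periodic ψ (2 * Real.pi) := hper
    have h1 := hp.intervalIntegral_add_eq 0 φ
    rw [zero_add, h2π] at h1
    have h2 := intervalIntegral.integral_add_adjacent_intervals (hint 0 φ)
      (hint φ (φ + 2 * Real.pi))
    simp only [hθ]
    rw [← h2, ← h1]
  have hnat : ∀ n : ℕ, θ (n * (2 * Real.pi)) = n * T := by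
    intro n
    induction n with
    | zero => simp [h0]
    | succ n ih =>
      rw [Nat.cast_succ, add_mul, one_mul, hshift, ih]; ring
  -- Each full turn adds T > 0, so θ is unbounded and hence onto.
  have htop : Tendsto θ atTop atTop := by
    refine tendsto_atTop_atTop_of_monotone hmono.monotone fun b => ?_
    obtain ⟨n, hn⟩ := exists_nat_ge (b / T)
    refine ⟨n * (2 * Real.pi), ?_⟩
    rw [hnat]
    exact (div_le_iff₀ hTpos).1 hn
  have hbot : Tendsto θ atBot atBot := by
    have h1 : θ = fun x => -θ (-x) := funext fun x => by rw [hodd, neg_neg]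
    rw [h1]
    exact tendsto_neg_atTop_atBot.comp (htop.comp tendsto_neg_atBot_atTop)
  have hsurj : Function.Surjective θ := hθs.continuous.surjective htop hbot
  obtain ⟨Φ, hΦ⟩ := hsurj.hasRightInverse
  have hΦ' : ∀ x, Φ (θ x) = x := fun x => hmono.injective (hΦ _)
  have hinv := fun x => contDiffAt_hasDerivAt_leftInverse isOpen_univ hθs.contDiffOn
    (fun x _ => by rw [hdθ]; exact hpos x) (fun x _ => hΦ' x) (mem_univ x)
  have key : ∀ x, ContDiffAt ℝ ∞ Φ x ∧ HasDerivAt Φ (ψ (Φ x))⁻¹ x := by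
    intro x
    have := hinv (Φ x)
    rwa [hΦ x, hdθ] at this
  refine ⟨hTpos, Φ, contDiff_iff_contDiffAt.2 fun x => (key x).1, ?_, fun x => (key x).2, ?_, ?_,
    ?_, ?_⟩
  · intro x z hxz
    by_contra! h
    have := hmono.monotone h
    rw [hΦ, hΦ] at this
    linarith
  · rw [← h0, hΦ', h0]
  · rw [← hπ, hΦ']
  · intro x
    apply hmono.injective
    rw [hodd, hΦ, hΦ]
  · intro x
    apply hmono.injective
    rw [hshift, hΦ, hΦ]

end PhaseInverse

/-! ### Oscillation between two turning points -/

section Oscillation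

variable {a b ε : ℝ} {y S w : ℝ → ℝ}

theorem leftInverse_image_mem (hS : ∀ x ∈ Ioo a b, S (y x) = x) {z : ℝ} (hz : z ∈ y '' Ioo a b) :
    S z ∈ Ioo a b ∧ y (S z) = z := by
  obtain ⟨x, hx, rfl⟩ := hz
  rw [hS x hx]
  exact ⟨hx, rfl⟩

theorem neg_mul_cos_mem (hε : 0 < ε) (φ : ℝ) : -ε * Real.cos φ ∈ Icc (-ε) ε := by
  have h1 := Real.neg_one_le_cos φ
  have h2 := Real.cos_le_one φ
  constructor <;> nlinarith

theorem sublevel_eq_Ioo (hy : ContDiffOn ℝ ∞ y (Ioo a b))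
    (hd : ∀ s ∈ Ioo a b, 0 < deriv y s) (hS : ∀ x ∈ Ioo a b, S (y x) = x) (hε : 0 < ε)
    (hsub : Icc (-ε) ε ⊆ y '' Ioo a b) :
    {s | s ∈ Ioo a b ∧ |y s| < ε} = Ioo (S (-ε)) (S ε) ∧ S (-ε) < S ε := by
  have hm : StrictMonoOn y (Ioo a b) :=
    strictMonoOn_of_deriv_pos (convex_Ioo _ _) hy.continuousOn fun x hx => by
      rw [interior_Ioo] at hx; exact hd x hx
  obtain ⟨h1, h1'⟩ := leftInverse_image_mem hS (hsub (left_mem_Icc.2 (by linarith)))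
  obtain ⟨h2, h2'⟩ := leftInverse_image_mem hS (hsub (right_mem_Icc.2 (by linarith)))
  constructor
  · ext s
    constructor
    · rintro ⟨hs, hs2⟩
      rw [abs_lt] at hs2
      constructor
      · rw [← hm.lt_iff_lt h1 hs, h1']; exact hs2.1
      · rw [← hm.lt_iff_lt hs h2, h2']; exact hs2.2
    · intro hs
      have hsI : s ∈ Ioo a b := ⟨h1.1.trans hs.1, hs.2.trans h2.2⟩
      refine ⟨hsI, abs_lt.2 ⟨?_, ?_⟩⟩
      · rw [← h1']; exact hm h1 hsI hs.1
      · conv_rhs => rw [← h2']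
        exact hm hsI h2 hs.2
  · rw [← hm.lt_iff_lt h1 h2, h1', h2']; linarith

/-- The substitution `y s = -ε cos φ` regularizes `w / √(ε² - y²)`. -/
theorem integral_regularization (hy : ContDiffOn ℝ ∞ y (Ioo a b))
    (hd : ∀ s ∈ Ioo a b, 0 < deriv y s) (hS : ∀ x ∈ Ioo a b, S (y x) = x) (hε : 0 < ε)
    (hsub : Icc (-ε) ε ⊆ y '' Ioo a b) (hw : ContinuousOn w (Ioo a b)) :
    IntegrableOn (fun s => w s / √(ε ^ 2 - y s ^ 2)) {s | s ∈ Ioo a b ∧ |y s| < ε} ∧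
    ∫ s in {s | s ∈ Ioo a b ∧ |y s| < ε}, w s / √(ε ^ 2 - y s ^ 2) =
      ∫ φ in (0 : ℝ)..Real.pi, w (S (-ε * Real.cos φ)) / deriv y (S (-ε * Real.cos φ)) := by
  set f : ℝ → ℝ := fun φ => S (-ε * Real.cos φ) with hf
  have hmem : ∀ φ, f φ ∈ Ioo a b ∧ y (f φ) = -ε * Real.cos φ := fun φ =>
    leftInverse_image_mem hS (hsub (neg_mul_cos_mem hε φ))
  have hder : ∀ φ, HasDerivAt f ((deriv y (f φ))⁻¹ * (ε * Real.sin φ)) φ := by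
    intro φ
    have h1 := (contDiffAt_hasDerivAt_leftInverse isOpen_Ioo hy hd hS (hmem φ).1).2
    rw [(hmem φ).2] at h1
    have h2 : HasDerivAt (fun φ => -ε * Real.cos φ) (ε * Real.sin φ) φ :=
      ((Real.hasDerivAt_cos φ).const_mul (-ε)).congr_deriv (by ring)
    exact h1.comp φ h2
  have hinj : InjOn f (Ioo 0 Real.pi) := by
    intro x hx z hz hxz
    have : -ε * Real.cos x = -ε * Real.cos z := by rw [← (hmem x).2, ← (hmem z).2, hxz]
    exact Real.injOn_cos (Ioo_subset_Icc_self hx) (Ioo_subset_Icc_self hz)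
      (mul_left_cancel₀ (by linarith : -ε ≠ 0) this)
  have himg : f '' Ioo 0 Real.pi = {s | s ∈ Ioo a b ∧ |y s| < ε} := by
    ext s
    constructor
    · rintro ⟨φ, hφ, rfl⟩
      refine ⟨(hmem φ).1, ?_⟩
      rw [(hmem φ).2]
      apply abs_lt_of_sq_lt_sq _ hε.le
      have h1 := Real.sin_pos_of_pos_of_lt_pi hφ.1 hφ.2
      have h2 := Real.sin_sq_add_cos_sq φ
      nlinarith [mul_pos (mul_pos hε hε) (mul_pos h1 h1)]
    · rintro ⟨hs, hys⟩
      rw [abs_lt] at hys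
      refine ⟨Real.arccos (-(y s) / ε), ⟨?_, ?_⟩, ?_⟩
      · rw [Real.arccos_pos, div_lt_one hε]; linarith
      · refine lt_of_le_of_ne (Real.arccos_le_pi _) fun h => ?_
        rw [Real.arccos_eq_pi, div_le_iff₀ hε] at h
        linarith
      · simp only [hf]
        rw [Real.cos_arccos (by rw [le_div_iff₀ hε]; linarith) (by rw [div_le_one hε]; linarith),
          show -ε * (-(y s) / ε) = y s by field_simp, hS s hs]
  -- The Jacobian ε sin φ / y' cancels √(ε² - y²) = ε sin φ. What remains is continuous on the whole
  -- line, whence the integrability.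
  have heq : ∀ φ ∈ Ioo 0 Real.pi,
      |(deriv y (f φ))⁻¹ * (ε * Real.sin φ)| • (w (f φ) / √(ε ^ 2 - y (f φ) ^ 2)) =
        w (f φ) / deriv y (f φ) := by
    intro φ hφ
    have h1 := Real.sin_pos_of_pos_of_lt_pi hφ.1 hφ.2
    have h2 := hd _ (hmem φ).1
    rw [(hmem φ).2, show ε ^ 2 - (-ε * Real.cos φ) ^ 2 = (ε * Real.sin φ) ^ 2 by
      rw [mul_pow, mul_pow, Real.sin_sq]; ring, Real.sqrt_sq (by positivity),
      abs_of_pos (by positivity), smul_eq_mul]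
    field_simp
  have hcont : Continuous fun φ => w (f φ) / deriv y (f φ) := by
    have hfc : Continuous f := continuous_iff_continuousAt.2 fun φ => (hder φ).continuousAt
    have hdy : ContinuousOn (deriv y) (Ioo a b) :=
      hy.continuousOn_deriv_of_isOpen isOpen_Ioo (by simp)
    exact (hw.div hdy fun s hs => (hd s hs).ne').comp_continuous hfc fun φ => (hmem φ).1
  rw [← himg]
  constructor
  · rw [integrableOn_image_iff_integrableOn_abs_deriv_smul measurableSet_Ioo
      (fun x _ => (hder x).hasDerivWithinAt) hinj, integrableOn_congr_fun heq measurableSet_Ioo]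
    exact (hcont.integrableOn_Icc).mono_set Ioo_subset_Icc_self
  · rw [integral_image_eq_integral_abs_deriv_smul measurableSet_Ioo
      (fun x _ => (hder x).hasDerivWithinAt) hinj, setIntegral_congr_fun measurableSet_Ioo heq,
      intervalIntegral.integral_of_le Real.pi_pos.le, integral_Ioc_eq_integral_Ioo]

/-- The oscillation in the potential well of `y²`, of energy `ε²`, with speed `√(ε² - y²) / w`. -/
theorem exists_oscillation (hy : ContDiffOn ℝ ∞ y (Ioo a b))
    (hd : ∀ s ∈ Ioo a b, 0 < deriv y s) (hS : ∀ x ∈ Ioo a b, S (y x) = x) (hε : 0 < ε)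
    (hsub : Icc (-ε) ε ⊆ y '' Ioo a b) (hw : ContDiffOn ℝ ∞ w (Ioo a b))
    (hwpos : ∀ s ∈ Ioo a b, 0 < w s) {J : Set ℝ} (hJ : J = {s | s ∈ Ioo a b ∧ |y s| < ε})
    {T : ℝ} (hT : T = 2 * ∫ s in J, w s / √(ε ^ 2 - y s ^ 2)) :
    ∃ σ : ℝ → ℝ, ContDiff ℝ ∞ σ ∧ σ 0 = sInf J ∧ σ (T / 2) = sSup J ∧
      StrictMonoOn σ (Icc 0 (T / 2)) ∧ MapsTo σ (Ioo 0 (T / 2)) J ∧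
      (∀ θ ∈ Ioo 0 (T / 2), HasDerivAt σ (w (σ θ) / √(ε ^ 2 - y (σ θ) ^ 2))⁻¹ θ) ∧
      Function.Even σ ∧ Function.Periodic σ T ∧ (∀ θ, σ θ ∈ Ioo a b) ∧
      (∀ θ, deriv σ θ ^ 2 = (ε ^ 2 - y (σ θ) ^ 2) / w (σ θ) ^ 2) ∧
      {θ | deriv σ θ = 0}.Countable := by
  set f : ℝ → ℝ := fun φ => S (-ε * Real.cos φ) with hf
  have hmem : ∀ φ, f φ ∈ Ioo a b ∧ y (f φ) = -ε * Real.cos φ := fun φ =>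
    leftInverse_image_mem hS (hsub (neg_mul_cos_mem hε φ))
  have hfs : ContDiff ℝ ∞ f := by
    refine contDiff_iff_contDiffAt.2 fun φ => ?_
    have h1 := (contDiffAt_hasDerivAt_leftInverse isOpen_Ioo hy hd hS (hmem φ).1).1
    rw [(hmem φ).2] at h1
    exact h1.comp φ (contDiff_const.mul Real.contDiff_cos).contDiffAt
  have hder : ∀ φ, HasDerivAt f ((deriv y (f φ))⁻¹ * (ε * Real.sin φ)) φ := by
    intro φ
    have h1 := (contDiffAt_hasDerivAt_leftInverse isOpen_Ioo hy hd hS (hmem φ).1).2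
    rw [(hmem φ).2] at h1
    have h2 : HasDerivAt (fun φ => -ε * Real.cos φ) (ε * Real.sin φ) φ :=
      ((Real.hasDerivAt_cos φ).const_mul (-ε)).congr_deriv (by ring)
    exact h1.comp φ h2
  have hdy : ContDiffOn ℝ ∞ (deriv y) (Ioo a b) :=
    ((contDiffOn_infty_iff_deriv_of_isOpen isOpen_Ioo).1 hy).2
  have hψs : ContDiff ℝ ∞ fun φ => w (f φ) / deriv y (f φ) :=
    (hw.div hdy fun s hs => (hd s hs).ne').comp_contDiff hfs fun φ => (hmem φ).1
  rw [hJ, (integral_regularization hy hd hS hε hsub hw.continuousOn).2] at hT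
  obtain ⟨hTpos, Φ, hΦs, hΦm, hΦd, hΦ0, hΦT, hΦodd, hΦper⟩ := exists_phase_inverse hψs
    (fun φ => div_pos (hwpos _ (hmem φ).1) (hd _ (hmem φ).1))
    (fun φ => by simp only [hf, Real.cos_neg]) (fun φ => by simp only [hf, Real.cos_add_two_pi]) hT
  obtain ⟨hJ2, hlt⟩ := sublevel_eq_Ioo hy hd hS hε hsub
  have hm : StrictMonoOn y (Ioo a b) :=
    strictMonoOn_of_deriv_pos (convex_Ioo _ _) hy.continuousOn fun x hx => by
      rw [interior_Ioo] at hx; exact hd x hx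
  have hΦmem : ∀ θ ∈ Ioo 0 (T / 2), Φ θ ∈ Ioo 0 Real.pi := fun θ hθ =>
    ⟨by rw [← hΦ0]; exact hΦm hθ.1, by rw [← hΦT]; exact hΦm hθ.2⟩
  have hσd : ∀ θ, HasDerivAt (fun θ => f (Φ θ)) (ε * Real.sin (Φ θ) / w (f (Φ θ))) θ := by
    intro θ
    refine ((hder (Φ θ)).comp θ (hΦd θ)).congr_deriv ?_
    have h1 := hd _ (hmem (Φ θ)).1
    have h2 := hwpos _ (hmem (Φ θ)).1
    field_simp
  have hsq : ∀ φ, ε ^ 2 - y (f φ) ^ 2 = (ε * Real.sin φ) ^ 2 := by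
    intro φ
    rw [(hmem φ).2, mul_pow, mul_pow, Real.sin_sq]; ring
  -- Reflection and periodicity of σ come from those of the cosine, with no gluing at the turning
  -- points.
  refine ⟨fun θ => f (Φ θ), hfs.comp hΦs, ?_, ?_, ?_, ?_, ?_, ?_, ?_, fun θ => (hmem _).1, ?_, ?_⟩
  · rw [hJ, hJ2, csInf_Ioo hlt]; simp [hf, hΦ0]
  · rw [hJ, hJ2, csSup_Ioo hlt]; simp [hf, hΦT]
  · intro x hx z hz hxz
    have h1 := hΦm hxz
    rw [← hm.lt_iff_lt (hmem _).1 (hmem _).1, (hmem _).2, (hmem _).2]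
    have h2 : Real.cos (Φ z) < Real.cos (Φ x) := by
      refine Real.strictAntiOn_cos ⟨?_, ?_⟩ ⟨?_, ?_⟩ h1
      · rw [← hΦ0]; exact hΦm.monotone hx.1
      · rw [← hΦT]; exact hΦm.monotone hx.2
      · rw [← hΦ0]; exact hΦm.monotone hz.1
      · rw [← hΦT]; exact hΦm.monotone hz.2
    nlinarith
  · intro θ hθ
    rw [hJ]
    refine ⟨(hmem _).1, abs_lt_of_sq_lt_sq ?_ hε.le⟩
    have h1 := hΦmem θ hθ
    have h2 := Real.sin_pos_of_pos_of_lt_pi h1.1 h1.2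
    have h3 := hsq (Φ θ)
    have : 0 < (ε * Real.sin (Φ θ)) ^ 2 := by positivity
    linarith
  · intro θ hθ
    refine (hσd θ).congr_deriv ?_
    have h1 := hΦmem θ hθ
    have h2 := Real.sin_pos_of_pos_of_lt_pi h1.1 h1.2
    rw [hsq, Real.sqrt_sq (by positivity), inv_div]
  · intro θ
    simp only [hf, hΦodd, Real.cos_neg]
  · intro θ
    simp only [hf, hΦper, Real.cos_add_two_pi]
  · intro θ
    rw [(hσd θ).deriv, hsq, div_pow]
  -- σ' vanishes only where sin Φ does, that is where Φ is an integer multiple of π.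
  · refine ((countable_range fun n : ℤ => (n : ℝ) * Real.pi).preimage hΦm.injective).mono ?_
    intro θ hθ
    have h1 : deriv (fun θ => f (Φ θ)) θ = 0 := hθ
    rw [(hσd θ).deriv] at h1
    have h2 := hwpos _ (hmem (Φ θ)).1
    have h3 : Real.sin (Φ θ) = 0 := by
      rcases div_eq_zero_iff.1 h1 with h | h
      · exact (mul_eq_zero.1 h).resolve_left hε.ne'
      · exact absurd h h2.ne'
    obtain ⟨n, hn⟩ := Real.sin_eq_zero_iff.1 h3
    exact ⟨n, hn⟩

end Oscillation

/-! ### The gap function and the factorization of the phase derivative -/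

namespace Delaunay

open Filter Topology

/-- The function `L - R + C`, whose superlevel sets are the intervals `J n h C`. -/
noncomputable def gap (n : ℕ) (h s : ℝ) : ℝ := L n s - h / ((n : ℝ) - 1) * Real.sin s ^ (n - 1)

/-- The regular factor of `phaseDeriv`. -/
noncomputable def weight (n : ℕ) (h C s : ℝ) : ℝ :=
  R n h C s / (Real.cos s * √(L n s + R n h C s))

section Basic

variable {n : ℕ} {h C s : ℝ}

theorem L_sub_R : L n s - R n h C s = gap n h s - C := by unfold R gap; ring

theorem sin_pos_of_mem (hs : s ∈ Ioo 0 (Real.pi / 2)) : 0 < Real.sin s :=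
  Real.sin_pos_of_pos_of_lt_pi hs.1 (by linarith [hs.2, Real.pi_pos])

theorem cos_pos_of_mem (hs : s ∈ Ioo 0 (Real.pi / 2)) : 0 < Real.cos s :=
  Real.cos_pos_of_mem_Ioo ⟨by linarith [hs.1, Real.pi_pos], hs.2⟩

theorem L_pos (hs : s ∈ Ioo 0 (Real.pi / 2)) : 0 < L n s :=
  mul_pos (cos_pos_of_mem hs) (pow_pos (sin_pos_of_mem hs) _)

theorem sub_one_pos (hn : 3 ≤ n) : (0 : ℝ) < (n : ℝ) - 1 := by
  have : (3 : ℝ) ≤ n := by exact_mod_cast hn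
  linarith

theorem sub_two_pos (hn : 3 ≤ n) : (0 : ℝ) < (n : ℝ) - 2 := by
  have : (3 : ℝ) ≤ n := by exact_mod_cast hn
  linarith

theorem R_pos (hn : 3 ≤ n) (hh : 0 < h) (hC : 0 < C) (hs : s ∈ Ioo 0 (Real.pi / 2)) :
    0 < R n h C s := by
  have := sin_pos_of_mem hs
  have := sub_one_pos hn
  unfold R
  positivity

theorem contDiff_R : ContDiff ℝ ∞ (R n h C) :=
  contDiff_const.add (contDiff_const.mul (Real.contDiff_sin.pow _))

theorem contDiff_L : ContDiff ℝ ∞ (L n) := Real.contDiff_cos.mul (Real.contDiff_sin.pow _)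

theorem analyticAt_gap : AnalyticAt ℝ (gap n h) s := by
  have hs : AnalyticAt ℝ Real.sin s := Real.analyticAt_sin
  have hc : AnalyticAt ℝ Real.cos s := Real.analyticAt_cos
  exact (hc.mul (hs.pow _)).sub (analyticAt_const.mul (hs.pow _))

theorem continuous_gap : Continuous (gap n h) :=
  continuous_iff_continuousAt.2 fun _ => analyticAt_gap.continuousAt

theorem contDiffOn_weight (hn : 3 ≤ n) (hh : 0 < h) (hC : 0 < C) :
    ContDiffOn ℝ ∞ (weight n h C) (Ioo 0 (Real.pi / 2)) := by
  intro s hs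
  have h1 := R_pos hn hh hC hs
  have h2 := L_pos (n := n) hs
  have h3 := cos_pos_of_mem hs
  have h4 : ContDiffAt ℝ ∞ (fun s => √(L n s + R n h C s)) s :=
    (contDiff_L.contDiffAt.add contDiff_R.contDiffAt).sqrt (by positivity)
  exact (contDiff_R.contDiffAt.div (Real.contDiff_cos.contDiffAt.mul h4)
    (by positivity)).contDiffWithinAt

theorem weight_pos (hn : 3 ≤ n) (hh : 0 < h) (hC : 0 < C) (hs : s ∈ Ioo 0 (Real.pi / 2)) :
    0 < weight n h C s := by
  have h1 := R_pos hn hh hC hs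
  have h2 := L_pos (n := n) hs
  have h3 := cos_pos_of_mem hs
  unfold weight
  positivity

theorem mem_J_iff (hn : 3 ≤ n) (hh : 0 < h) (hC : 0 < C) :
    s ∈ J n h C ↔ s ∈ Ioo 0 (Real.pi / 2) ∧ C < gap n h s := by
  refine and_congr_right fun hs => ?_
  rw [abs_of_pos (R_pos hn hh hC hs)]
  have := L_sub_R (n := n) (h := h) (C := C) (s := s)
  constructor <;> intro <;> linarith

theorem sq_sub_sq_eq : Real.cos s ^ 2 * Real.sin s ^ (2 * (n - 2)) - R n h C s ^ 2 =
    (L n s + R n h C s) * (gap n h s - C) := by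
  rw [← L_sub_R]; unfold L
  rw [mul_comm 2, pow_mul]; ring

/-- Factoring L² - R² as (L + R)(L - R) isolates the singular factor L - R; L + R stays positive on
the whole of (0, π/2). -/
theorem phaseDeriv_eq_weight (hn : 3 ≤ n) (hh : 0 < h) (hC : 0 < C)
    (hs : s ∈ Ioo 0 (Real.pi / 2)) :
    phaseDeriv n h C s = weight n h C s / √(gap n h s - C) := by
  have h1 := R_pos hn hh hC hs
  have h2 := L_pos (n := n) hs
  unfold phaseDeriv weight
  rw [sq_sub_sq_eq, Real.sqrt_mul (by positivity), div_div, mul_assoc]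

end Basic

/-! ### Unimodality of the gap function and its Morse coordinate -/

section Contact

variable {n : ℕ} {h s : ℝ}

/-- The tangent of the contact point. -/
theorem tan_contactPoint (hn : 3 ≤ n) (hh : 0 < h) :
    0 < Real.tan (contactPoint n h) ∧
      ((n : ℝ) - 2) / Real.tan (contactPoint n h) - Real.tan (contactPoint n h) = h := by
  have h2 := sub_two_pos hn
  have hr : 0 ≤ h ^ 2 + 4 * ((n : ℝ) - 2) := by positivity
  have hq := Real.sq_sqrt hr
  have hq0 := Real.sqrt_nonneg (h ^ 2 + 4 * ((n : ℝ) - 2))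
  rw [contactPoint, Real.tan_arctan]
  set q := √(h ^ 2 + 4 * ((n : ℝ) - 2))
  have hp : 0 < h + q := by linarith
  refine ⟨by positivity, ?_⟩
  field_simp
  nlinarith

theorem contactPoint_mem (hn : 3 ≤ n) (hh : 0 < h) : contactPoint n h ∈ Ioo 0 (Real.pi / 2) := by
  have h2 := sub_two_pos hn
  refine ⟨Real.arctan_pos.2 ?_, Real.arctan_lt_pi_div_two _⟩
  positivity

theorem hasDerivAt_gap' (hn : 3 ≤ n) :
    HasDerivAt (gap n h) (Real.sin s ^ (n - 3) *
      (((n : ℝ) - 2) * Real.cos s ^ 2 - Real.sin s ^ 2 - h * Real.sin s * Real.cos s)) s := by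
  obtain ⟨m, rfl⟩ := Nat.exists_eq_add_of_le' hn
  have hs := Real.hasDerivAt_sin s
  have hc := Real.hasDerivAt_cos s
  have h1 := (hc.mul (hs.pow (m + 1))).sub ((hs.pow (m + 2)).const_mul (h / ((m : ℝ) + 2)))
  have h2 : gap (m + 3) h = fun s => Real.cos s * Real.sin s ^ (m + 1) -
      h / ((m : ℝ) + 2) * Real.sin s ^ (m + 2) := by
    funext s
    simp only [gap, L]
    push_cast
    rw [show (m : ℝ) + 3 - 1 = m + 2 by ring]
  rw [h2]
  refine h1.congr_deriv ?_
  have h3 : (m : ℝ) + 2 ≠ 0 := by positivity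
  change -Real.sin s * Real.sin s ^ (m + 1) +
      Real.cos s * (((m + 1 : ℕ) : ℝ) * Real.sin s ^ m * Real.cos s) -
      h / (m + 2) * (((m + 2 : ℕ) : ℝ) * Real.sin s ^ (m + 1) * Real.cos s) =
    Real.sin s ^ m * ((((m + 3 : ℕ) : ℝ) - 2) * Real.cos s ^ 2 - Real.sin s ^ 2 -
      h * Real.sin s * Real.cos s)
  push_cast
  field_simp
  ring

/-- Divided by cos² s, the bracket in `hasDerivAt_gap'` is a quadratic polynomial in tan s with
roots t = tan s_h and -(n-2)/t. Only the first is positive, so the sign of the derivative is that of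
tan s_h - tan s. -/
theorem hasDerivAt_gap (hn : 3 ≤ n) (hh : 0 < h) (hs : s ∈ Ioo 0 (Real.pi / 2)) :
    HasDerivAt (gap n h) ((Real.tan (contactPoint n h) - Real.tan s) *
      (Real.sin s ^ (n - 3) * Real.cos s ^ 2 *
        (Real.tan s + ((n : ℝ) - 2) / Real.tan (contactPoint n h)))) s := by
  obtain ⟨h1, h2⟩ := tan_contactPoint hn hh
  set t := Real.tan (contactPoint n h)
  refine (hasDerivAt_gap' hn).congr_deriv ?_
  have h3 := cos_pos_of_mem hs
  have h4 : Real.sin s = Real.tan s * Real.cos s := (Real.tan_mul_cos h3.ne').symm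
  have h5 : (n : ℝ) - 2 = (h + t) * t := by rw [← h2]; field_simp; ring
  rw [h5, mul_div_assoc, div_self h1.ne', mul_one]
  have h6 : h * Real.sin s * Real.cos s = h * Real.tan s * Real.cos s ^ 2 := by rw [h4]; ring
  have h7 : Real.sin s ^ 2 = Real.tan s ^ 2 * Real.cos s ^ 2 := by rw [h4]; ring
  rw [h6, h7]
  ring

theorem gap_factor_pos (hn : 3 ≤ n) (hh : 0 < h) (hs : s ∈ Ioo 0 (Real.pi / 2)) :
    0 < Real.sin s ^ (n - 3) * Real.cos s ^ 2 *
        (Real.tan s + ((n : ℝ) - 2) / Real.tan (contactPoint n h)) := by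
  have h1 := (tan_contactPoint hn hh).1
  have h2 := sub_two_pos hn
  have h3 := cos_pos_of_mem hs
  have h4 := sin_pos_of_mem hs
  have h5 := Real.tan_pos_of_pos_of_lt_pi_div_two hs.1 hs.2
  positivity

theorem tan_lt_tan_iff {x z : ℝ} (hx : x ∈ Ioo 0 (Real.pi / 2)) (hz : z ∈ Ioo 0 (Real.pi / 2)) :
    Real.tan x < Real.tan z ↔ x < z :=
  Real.strictMonoOn_tan.lt_iff_lt ⟨by linarith [hx.1, Real.pi_pos], hx.2⟩
    ⟨by linarith [hz.1, Real.pi_pos], hz.2⟩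

theorem deriv_gap_pos (hn : 3 ≤ n) (hh : 0 < h) (hs : s ∈ Ioo 0 (contactPoint n h)) :
    0 < deriv (gap n h) s := by
  have hc := contactPoint_mem hn hh
  have hs' : s ∈ Ioo 0 (Real.pi / 2) := ⟨hs.1, hs.2.trans hc.2⟩
  rw [(hasDerivAt_gap hn hh hs').deriv]
  have := (tan_lt_tan_iff hs' hc).2 hs.2
  exact mul_pos (by linarith) (gap_factor_pos hn hh hs')

theorem deriv_gap_neg (hn : 3 ≤ n) (hh : 0 < h) (hs : s ∈ Ioo (contactPoint n h) (Real.pi / 2)) :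
    deriv (gap n h) s < 0 := by
  have hc := contactPoint_mem hn hh
  have hs' : s ∈ Ioo 0 (Real.pi / 2) := ⟨hc.1.trans hs.1, hs.2⟩
  rw [(hasDerivAt_gap hn hh hs').deriv]
  have := (tan_lt_tan_iff hc hs').2 hs.1
  exact mul_neg_of_neg_of_pos (by linarith) (gap_factor_pos hn hh hs')

theorem deriv_gap_contactPoint (hn : 3 ≤ n) (hh : 0 < h) :
    deriv (gap n h) (contactPoint n h) = 0 := by
  rw [(hasDerivAt_gap hn hh (contactPoint_mem hn hh)).deriv, sub_self, zero_mul]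

/-- The first factor in `hasDerivAt_gap` vanishes at s_h, so only its derivative -1/cos²
contributes, and this cancels the cos² of the second factor. -/
theorem deriv_deriv_gap (hn : 3 ≤ n) (hh : 0 < h) :
    deriv (deriv (gap n h)) (contactPoint n h) = -(Real.sin (contactPoint n h) ^ (n - 3) *
      (Real.tan (contactPoint n h) + ((n : ℝ) - 2) / Real.tan (contactPoint n h))) := by
  have hc := contactPoint_mem hn hh
  set c := contactPoint n h with hcdef
  have h1 : deriv (gap n h) =ᶠ[𝓝 c] fun s => (Real.tan c - Real.tan s) *
      (Real.sin s ^ (n - 3) * Real.cos s ^ 2 * (Real.tan s + ((n : ℝ) - 2) / Real.tan c)) := by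
    filter_upwards [isOpen_Ioo.mem_nhds hc] with s hs using (hasDerivAt_gap hn hh hs).deriv
  rw [h1.deriv_eq]
  have hcos := cos_pos_of_mem hc
  have ht : HasDerivAt Real.tan (1 / Real.cos c ^ 2) c := Real.hasDerivAt_tan hcos.ne'
  have h2 : DifferentiableAt ℝ (fun s => Real.sin s ^ (n - 3) * Real.cos s ^ 2 *
      (Real.tan s + ((n : ℝ) - 2) / Real.tan c)) c :=
    ((Real.differentiableAt_sin.pow _).mul (Real.differentiableAt_cos.pow _)).mul
      (ht.differentiableAt.add_const _)
  refine ((ht.const_sub (Real.tan c)).mul h2.hasDerivAt).deriv.trans ?_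
  field_simp
  ring

theorem gap_zero (hn : 3 ≤ n) : gap n h 0 = 0 := by
  simp [gap, L, show n - 2 ≠ 0 by omega, show n - 1 ≠ 0 by omega]

theorem gap_pi_div_two_neg (hn : 3 ≤ n) (hh : 0 < h) : gap n h (Real.pi / 2) < 0 := by
  have := sub_one_pos hn
  have h1 : 0 < h / ((n : ℝ) - 1) := by positivity
  simp [gap, L, h1]

theorem contactConstant_pos (hn : 3 ≤ n) (hh : 0 < h) : 0 < contactConstant n h := by
  have hc := contactPoint_mem hn hh
  have : StrictMonoOn (gap n h) (Icc 0 (contactPoint n h)) :=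
    strictMonoOn_of_deriv_pos (convex_Icc _ _) continuous_gap.continuousOn fun x hx => by
      rw [interior_Icc] at hx; exact deriv_gap_pos hn hh hx
  have h2 := this (left_mem_Icc.2 hc.1.le) (right_mem_Icc.2 hc.1.le) hc.1
  rwa [gap_zero hn] at h2

/-- The Morse coordinate of `gap` at the contact point. -/
theorem exists_gap_coordinate (hn : 3 ≤ n) (hh : 0 < h) :
    ∃ y S : ℝ → ℝ, ContDiffOn ℝ ∞ y (Ioo 0 (Real.pi / 2)) ∧
      (∀ s ∈ Ioo 0 (Real.pi / 2), gap n h s = contactConstant n h - y s ^ 2) ∧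
      (∀ s ∈ Ioo 0 (Real.pi / 2), 0 < deriv y s) ∧ y (contactPoint n h) = 0 ∧
      deriv y (contactPoint n h) ^ 2 = Real.sin (contactPoint n h) ^ (n - 3) *
      (Real.tan (contactPoint n h) + ((n : ℝ) - 2) / Real.tan (contactPoint n h)) / 2 ∧
      (∀ s ∈ Ioo 0 (Real.pi / 2), S (y s) = s) := by
  have hc := contactPoint_mem hn hh
  have ht := (tan_contactPoint hn hh).1
  have hs := sin_pos_of_mem hc
  have h2 := sub_two_pos hn
  obtain ⟨y, h1, h2, h3, h4, h5⟩ := exists_morse_coordinate (F := gap n h)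
    (fun s => analyticAt_gap) hc (fun s hs => deriv_gap_pos hn hh hs)
    (fun s hs => deriv_gap_neg hn hh hs) (deriv_gap_contactPoint hn hh)
    (by rw [deriv_deriv_gap hn hh, neg_lt_zero]; positivity)
  have hm : StrictMonoOn y (Ioo 0 (Real.pi / 2)) :=
    strictMonoOn_of_deriv_pos (convex_Ioo _ _) h1.continuousOn fun x hx => by
      rw [interior_Ioo] at hx; exact h3 x hx
  refine ⟨y, Function.invFunOn y (Ioo 0 (Real.pi / 2)), h1, h2, h3, h4, ?_, ?_⟩
  · rw [h5, deriv_deriv_gap hn hh, neg_neg]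
  · intro s hs
    exact hm.injOn.leftInvOn_invFunOn hs

/-- `gap` is 0 at 0 and negative at π/2, so it drops below C > 0 on both sides of s_h inside the
interval. There |y| exceeds √(C_h - C), and the intermediate value theorem fills in the rest: both
turning points are interior. -/
theorem Icc_subset_image (hn : 3 ≤ n) (hh : 0 < h) {y : ℝ → ℝ}
    (hy : ContDiffOn ℝ ∞ y (Ioo 0 (Real.pi / 2)))
    (hg : ∀ s ∈ Ioo 0 (Real.pi / 2), gap n h s = contactConstant n h - y s ^ 2)
    (hd : ∀ s ∈ Ioo 0 (Real.pi / 2), 0 < deriv y s) (hc0 : y (contactPoint n h) = 0) {C : ℝ}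
    (hC : 0 < C) :
    Icc (-√(contactConstant n h - C)) (√(contactConstant n h - C)) ⊆
      y '' Ioo 0 (Real.pi / 2) := by
  have hc := contactPoint_mem hn hh
  set c := contactPoint n h
  have hm : StrictMonoOn y (Ioo 0 (Real.pi / 2)) :=
    strictMonoOn_of_deriv_pos (convex_Ioo _ _) hy.continuousOn fun x hx => by
      rw [interior_Ioo] at hx; exact hd x hx
  have hl : ∃ s ∈ Ioo 0 c, gap n h s < C := by
    have h1 : ∀ᶠ s in 𝓝 (0 : ℝ), gap n h s < C :=
      continuous_gap.continuousAt.eventually (gt_mem_nhds (by rwa [gap_zero hn]))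
    have h2 : ∀ᶠ s in 𝓝[>] (0 : ℝ), s ∈ Ioo 0 c := Ioo_mem_nhdsGT hc.1
    exact (h2.and (h1.filter_mono nhdsWithin_le_nhds)).exists
  have hr : ∃ s ∈ Ioo c (Real.pi / 2), gap n h s < C := by
    have h1 : ∀ᶠ s in 𝓝 (Real.pi / 2), gap n h s < C :=
      continuous_gap.continuousAt.eventually
        (gt_mem_nhds ((gap_pi_div_two_neg hn hh).trans hC))
    have h2 : ∀ᶠ s in 𝓝[<] (Real.pi / 2), s ∈ Ioo c (Real.pi / 2) := Ioo_mem_nhdsLT hc.2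
    exact (h2.and (h1.filter_mono nhdsWithin_le_nhds)).exists
  obtain ⟨s₁, hs₁, hs₁'⟩ := hl
  obtain ⟨s₂, hs₂, hs₂'⟩ := hr
  have hm₁ : s₁ ∈ Ioo 0 (Real.pi / 2) := ⟨hs₁.1, hs₁.2.trans hc.2⟩
  have hm₂ : s₂ ∈ Ioo 0 (Real.pi / 2) := ⟨hc.1.trans hs₂.1, hs₂.2⟩
  have hy₁ := hm hm₁ hc hs₁.2
  have hy₂ := hm hc hm₂ hs₂.1
  rw [hg _ hm₁] at hs₁'
  rw [hg _ hm₂] at hs₂'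
  rw [hc0] at hy₁ hy₂
  have hb₁ : √(contactConstant n h - C) < -y s₁ := by
    rw [Real.sqrt_lt' (by linarith)]; nlinarith
  have hb₂ : √(contactConstant n h - C) < y s₂ := by
    rw [Real.sqrt_lt' (by linarith)]; nlinarith
  intro z hz
  have hsub : Icc s₁ s₂ ⊆ Ioo 0 (Real.pi / 2) := fun x hx =>
    ⟨hm₁.1.trans_le hx.1, hx.2.trans_lt hm₂.2⟩
  have := intermediate_value_Icc (hs₁.2.trans hs₂.1).le (hy.continuousOn.mono hsub)
  exact image_mono hsub (this ⟨by linarith [hz.1], by linarith [hz.2]⟩)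

end Contact

end Delaunay

/-! ### Estimate of the half width for small C -/

namespace Delaunay

open Filter Topology

section SmallConstant

/-- The quotient `R / L` for `n = k + 3` and `a = h / (n - 1)`. -/
noncomputable def ratio (k : ℕ) (a C s : ℝ) : ℝ :=
  C / (Real.cos s * Real.sin s ^ (k + 1)) + a * Real.tan s

variable {k : ℕ} {a C s : ℝ}

theorem hasDerivAt_ratio (hs : s ∈ Ioo 0 (Real.pi / 2)) :
    HasDerivAt (ratio k a C) (C * (1 / (Real.cos s ^ 2 * Real.sin s ^ k) -
      (k + 1) / Real.sin s ^ (k + 2)) + a / Real.cos s ^ 2) s := by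
  have h1 := sin_pos_of_mem hs
  have h2 := cos_pos_of_mem hs
  have h3 := (((Real.hasDerivAt_cos s).mul ((Real.hasDerivAt_sin s).pow (k + 1))).fun_inv
    (by simp only [Pi.mul_apply, Pi.pow_apply]; positivity)).const_mul C
  have h4 := h3.add ((Real.hasDerivAt_tan h2.ne').const_mul a)
  refine h4.congr_deriv ?_
  simp only [Pi.mul_apply, Pi.pow_apply, Nat.add_sub_cancel]
  push_cast
  field_simp
  ring

theorem hasDerivAt_deriv_ratio (hs : s ∈ Ioo 0 (Real.pi / 2)) :
    HasDerivAt (fun s => C * (1 / (Real.cos s ^ 2 * Real.sin s ^ k) -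
      (k + 1) / Real.sin s ^ (k + 2)) + a / Real.cos s ^ 2)
      (C * (2 * Real.sin s ^ 4 - k * Real.sin s ^ 2 * Real.cos s ^ 2 +
        (k + 1) * (k + 2) * Real.cos s ^ 4) / (Real.cos s ^ 3 * Real.sin s ^ (k + 3)) +
        2 * a * Real.sin s / Real.cos s ^ 3) s := by
  have h1 := sin_pos_of_mem hs
  have h2 := cos_pos_of_mem hs
  have d1 := (((Real.hasDerivAt_cos s).pow 2).mul ((Real.hasDerivAt_sin s).pow k)).fun_inv
    (by simp only [Pi.mul_apply, Pi.pow_apply]; positivity)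
  have d2 := (((Real.hasDerivAt_sin s).pow (k + 2)).fun_inv
    (by simp only [Pi.pow_apply]; positivity)).const_mul ((k : ℝ) + 1)
  have d3 := (((Real.hasDerivAt_cos s).pow 2).fun_inv
    (by simp only [Pi.pow_apply]; positivity)).const_mul a
  have d4 := ((d1.sub d2).const_mul C).add d3
  refine (d4.congr_deriv ?_).congr_of_eventuallyEq (Eventually.of_forall fun x => by
    simp [div_eq_mul_inv])
  simp only [Pi.mul_apply, Pi.pow_apply]
  rcases k with _ | k
  · push_cast
    field_simp
    ring
  · simp only [Nat.add_sub_cancel]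
    push_cast
    field_simp
    ring

/-- Convexity forces the ratio to leave the value 1 at the left turning point at least linearly,
which controls the singularity there uniformly in C. -/
theorem convexOn_ratio (hC : 0 ≤ C) (ha : 0 ≤ a) :
    ConvexOn ℝ (Ioo 0 (Real.pi / 2)) (ratio k a C) := by
  refine MonotoneOn.convexOn_of_deriv (convex_Ioo _ _)
    (fun s hs => (hasDerivAt_ratio hs).continuousAt.continuousWithinAt)
    (fun s hs => ?_) ?_
  · rw [interior_Ioo] at hs
    exact (hasDerivAt_ratio hs).differentiableAt.differentiableWithinAt
  · rw [interior_Ioo]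
    have hm : MonotoneOn (fun s => C * (1 / (Real.cos s ^ 2 * Real.sin s ^ k) -
        (k + 1) / Real.sin s ^ (k + 2)) + a / Real.cos s ^ 2) (Ioo 0 (Real.pi / 2)) := by
      refine monotoneOn_of_deriv_nonneg (convex_Ioo _ _)
        (fun s hs => (hasDerivAt_deriv_ratio hs).continuousAt.continuousWithinAt)
        (fun s hs => ?_) (fun s hs => ?_)
      · rw [interior_Ioo] at hs
        exact (hasDerivAt_deriv_ratio hs).differentiableAt.differentiableWithinAt
      · rw [interior_Ioo] at hs
        rw [(hasDerivAt_deriv_ratio hs).deriv]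
        have h1 := sin_pos_of_mem hs
        have h2 := cos_pos_of_mem hs
        have h3 : 0 ≤ 2 * Real.sin s ^ 4 - k * Real.sin s ^ 2 * Real.cos s ^ 2 +
            (k + 1) * (k + 2) * Real.cos s ^ 4 := by
          have hk : (0 : ℝ) ≤ k := k.cast_nonneg
          -- Completing the square in sin² bounds the first two terms below by -(k²/8) cos⁴, which
          -- (k+1)(k+2) cos⁴ absorbs.
          have : 0 ≤ (8 * Real.sin s ^ 2 - 2 * k * Real.cos s ^ 2) ^ 2 := sq_nonneg _
          have h4 : 0 ≤ Real.cos s ^ 4 := by positivity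
          have h5 : 0 ≤ (k : ℝ) * Real.cos s ^ 4 := by positivity
          have h6 : 0 ≤ (k : ℝ) ^ 2 * Real.cos s ^ 4 := by positivity
          nlinarith
        positivity
    exact hm.congr fun s hs => (hasDerivAt_ratio hs).deriv.symm

/-- A bound on the half width, which tends to `1 / a` when `C → 0` and then `δ → 0`. -/
theorem integral_ratio_le {r₁ r₂ δ κ : ℝ} {f : ℝ → ℝ} (hC : 0 < C) (ha : 0 < a) (hr₁ : 0 < r₁)
    (hδ₁ : r₁ < δ) (hδ₂ : δ < r₂) (hr₂ : r₂ < Real.pi / 2) (he₁ : ratio k a C r₁ = 1)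
    (he₂ : ratio k a C r₂ = 1) (hlt : ∀ s ∈ Ioo r₁ r₂, ratio k a C s < 1)
    (hδ : ratio k a C δ ≤ 1 / 2) (hκ : 0 < κ) (hκ' : κ ≤ a - C * (k + 1) / Real.sin δ ^ (k + 2))
    (hfi : IntegrableOn f (Ioo r₁ r₂))
    (hf : ∀ s ∈ Ioo r₁ r₂, f s = ratio k a C s / (Real.cos s * √(1 - ratio k a C s ^ 2))) :
    ∫ s in Ioo r₁ r₂, f s ≤ 2 * √(2 * δ) * √δ / Real.cos δ + 1 / κ := by
  have hI : ∀ s ∈ Icc r₁ r₂, s ∈ Ioo 0 (Real.pi / 2) := fun s hs =>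
    ⟨hr₁.trans_le hs.1, hs.2.trans_lt hr₂⟩
  have hδI := hI δ ⟨hδ₁.le, hδ₂.le⟩
  have hcδ := cos_pos_of_mem hδI
  have hsδ := sin_pos_of_mem hδI
  have hδ0 : 0 < δ := hδI.1
  have hpos : ∀ s ∈ Icc r₁ r₂, 0 < ratio k a C s := fun s hs => by
    have h1 := sin_pos_of_mem (hI s hs)
    have h2 := cos_pos_of_mem (hI s hs)
    have h3 := Real.tan_pos_of_pos_of_lt_pi_div_two (hI s hs).1 (hI s hs).2
    unfold ratio; positivity
  have hfi' : IntegrableOn f (Icc r₁ r₂) := by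
    rwa [integrableOn_Icc_iff_integrableOn_Ioo]
  have hint₁ : IntervalIntegrable f volume r₁ δ :=
    (intervalIntegrable_iff_integrableOn_Icc_of_le hδ₁.le).2
      (hfi'.mono_set (Icc_subset_Icc le_rfl hδ₂.le))
  have hint₂ : IntervalIntegrable f volume δ r₂ :=
    (intervalIntegrable_iff_integrableOn_Icc_of_le hδ₂.le).2
      (hfi'.mono_set (Icc_subset_Icc hδ₁.le le_rfl))
  -- The chord from (r₁, 1) to (δ, ratio at δ) gives 1 - ratio ≥ (s - r₁)/(2δ), so f is at most a
  -- constant times 1/√(s - r₁).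
  have hleft : ∫ s in r₁..δ, f s ≤ 2 * √(2 * δ) * √δ / Real.cos δ := by
    have key := intervalIntegral.integral_le_sub_of_hasDeriv_right_of_le (φ := f)
      (g := fun s => 2 * √(2 * δ) / Real.cos δ * √(s - r₁))
      (g' := fun s => 2 * √(2 * δ) / Real.cos δ * (1 / (2 * √(s - r₁)))) hδ₁.le
      (by fun_prop) ?_ (hfi'.mono_set (Icc_subset_Icc le_rfl hδ₂.le)) ?_
    · refine key.trans ?_
      simp only [sub_self, Real.sqrt_zero, mul_zero, sub_zero]
      rw [div_mul_eq_mul_div]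
      gcongr
      linarith
    · intro s hs
      have h1 : s - r₁ ≠ 0 := by linarith [hs.1]
      exact ((((hasDerivAt_id s).sub_const r₁).sqrt h1).const_mul _).hasDerivWithinAt
    · intro s hs
      have hsJ : s ∈ Ioo r₁ r₂ := ⟨hs.1, hs.2.trans hδ₂⟩
      have hsc : s ∈ Icc r₁ r₂ := Ioo_subset_Icc_self hsJ
      have h1 := hpos s hsc
      have h2 := hlt s hsJ
      have h3 : Real.cos δ ≤ Real.cos s :=
        Real.cos_le_cos_of_nonneg_of_le_pi (hI s hsc).1.le (by linarith [hδI.2, Real.pi_pos]) hs.2.le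
      have h5 : 0 < δ - r₁ := by linarith
      have h4 : ratio k a C s ≤ 1 - (s - r₁) / (2 * δ) := by
        have := (convexOn_ratio (k := k) hC.le ha.le).2 (hI r₁ ⟨le_rfl, (hδ₁.trans hδ₂).le⟩) hδI
          (div_nonneg (by linarith [hs.2]) h5.le : 0 ≤ (δ - s) / (δ - r₁))
          (div_nonneg (by linarith [hs.1]) h5.le : 0 ≤ (s - r₁) / (δ - r₁))
          (by field_simp; ring)
        simp only [smul_eq_mul] at this
        rw [show (δ - s) / (δ - r₁) * r₁ + (s - r₁) / (δ - r₁) * δ = s by field_simp; ring,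
          he₁] at this
        have h6 : 0 ≤ (s - r₁) / (δ - r₁) := div_nonneg (by linarith [hs.1]) h5.le
        have h7 : (δ - s) / (δ - r₁) = 1 - (s - r₁) / (δ - r₁) := by field_simp; ring
        have h8 : (s - r₁) / (2 * δ) ≤ (s - r₁) / (δ - r₁) * (1 / 2) := by
          rw [div_mul_div_comm, mul_one]
          exact div_le_div_of_nonneg_left (by linarith [hs.1]) (by linarith) (by linarith)
        nlinarith
      have h9 : (s - r₁) / (2 * δ) ≤ 1 - ratio k a C s ^ 2 := by nlinarith
      have h10 : 0 < s - r₁ := by linarith [hs.1]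
      have h11 : √(s - r₁) / √(2 * δ) ≤ √(1 - ratio k a C s ^ 2) := by
        rw [← Real.sqrt_div h10.le]; exact Real.sqrt_le_sqrt h9
      have h12 : 0 < √(s - r₁) / √(2 * δ) := by positivity
      have h13 := cos_pos_of_mem (hI s hsc)
      rw [hf s hsJ]
      calc ratio k a C s / (Real.cos s * √(1 - ratio k a C s ^ 2))
          ≤ 1 / (Real.cos δ * (√(s - r₁) / √(2 * δ))) := by gcongr
        _ = 2 * √(2 * δ) / Real.cos δ * (1 / (2 * √(s - r₁))) := by field_simp
  -- To the right of δ the ratio ρ satisfies ρ' ≥ κ / cos s. Hence f ≤ (1/κ) ρρ' / √(1 - ρ²), the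
  -- derivative of -(1/κ) √(1 - ρ²), whose increment is at most 1/κ.
  have hright : ∫ s in δ..r₂, f s ≤ 1 / κ := by
    have hder : ∀ s ∈ Ioo δ r₂, 0 < 1 - ratio k a C s ^ 2 := fun s hs => by
      have h1 := hpos s ⟨(hδ₁.trans hs.1).le, hs.2.le⟩
      have h2 := hlt s ⟨hδ₁.trans hs.1, hs.2⟩
      nlinarith
    have key := intervalIntegral.integral_le_sub_of_hasDeriv_right_of_le (φ := f)
      (g := fun s => -(1 / κ) * √(1 - ratio k a C s ^ 2))
      (g' := fun s => -(1 / κ) * (-(2 * ratio k a C s * (C * (1 / (Real.cos s ^ 2 *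
        Real.sin s ^ k) - (k + 1) / Real.sin s ^ (k + 2)) + a / Real.cos s ^ 2)) /
        (2 * √(1 - ratio k a C s ^ 2)))) hδ₂.le ?_ ?_
      (hfi'.mono_set (Icc_subset_Icc hδ₁.le le_rfl)) ?_
    · refine key.trans ?_
      rw [he₂]
      simp only [one_pow, sub_self, Real.sqrt_zero, mul_zero, zero_sub, neg_mul, neg_neg]
      have : √(1 - ratio k a C δ ^ 2) ≤ 1 := by
        rw [Real.sqrt_le_left zero_le_one]
        nlinarith [sq_nonneg (ratio k a C δ)]
      exact mul_le_of_le_one_right (by positivity) this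
    · have : ContinuousOn (ratio k a C) (Icc δ r₂) := fun s hs =>
        (hasDerivAt_ratio (hI s ⟨hδ₁.le.trans hs.1, hs.2⟩)).continuousAt.continuousWithinAt
      exact continuousOn_const.mul ((continuousOn_const.sub (this.pow 2)).sqrt)
    · intro s hs
      have h1 := hasDerivAt_ratio (k := k) (a := a) (C := C)
        (hI s ⟨(hδ₁.trans hs.1).le, hs.2.le⟩)
      have h2 := (((h1.fun_pow 2).const_sub 1).sqrt (hder s hs).ne').const_mul (-(1 / κ))
      refine (h2.congr_deriv ?_).hasDerivWithinAt
      norm_num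
    · intro s hs
      have hsJ : s ∈ Ioo r₁ r₂ := ⟨hδ₁.trans hs.1, hs.2⟩
      have hsc : s ∈ Icc r₁ r₂ := Ioo_subset_Icc_self hsJ
      have h1 := hpos s hsc
      have h2 := cos_pos_of_mem (hI s hsc)
      have h3 := sin_pos_of_mem (hI s hsc)
      have h4 : Real.sin δ ≤ Real.sin s :=
        Real.sin_le_sin_of_le_of_le_pi_div_two (by linarith [Real.pi_pos]) (hI s hsc).2.le hs.1.le
      -- The first term in C is positive and dropped; the negative one is largest in size at δ, and
      -- factors 1/cos s ≥ 1 are inserted where needed.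
      have h5 : κ / Real.cos s ≤ C * (1 / (Real.cos s ^ 2 * Real.sin s ^ k) -
          (k + 1) / Real.sin s ^ (k + 2)) + a / Real.cos s ^ 2 := by
        have h6 : C * (k + 1) / Real.sin s ^ (k + 2) ≤ C * (k + 1) / Real.sin δ ^ (k + 2) := by
          gcongr
        have h7 : 0 < C * (1 / (Real.cos s ^ 2 * Real.sin s ^ k)) := by positivity
        have h8 : C * (k + 1) / Real.sin s ^ (k + 2) ≤
            C * (k + 1) / Real.sin s ^ (k + 2) / Real.cos s ^ 2 := by
          refine le_div_self (by positivity) (by positivity) ?_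
          nlinarith [Real.cos_le_one s]
        have h9 : κ / Real.cos s ≤ κ / Real.cos s ^ 2 := by
          refine div_le_div_of_nonneg_left hκ.le (by positivity) ?_
          nlinarith [Real.cos_le_one s]
        have h10 : κ / Real.cos s ^ 2 ≤
            a / Real.cos s ^ 2 - C * (k + 1) / Real.sin s ^ (k + 2) / Real.cos s ^ 2 := by
          rw [← sub_div]
          gcongr
          linarith
        rw [mul_sub, ← mul_div_assoc C ((k : ℝ) + 1)]
        linarith
      have hs0 := Real.sqrt_pos.2 (hder s hs)
      rw [hf s hsJ]
      calc ratio k a C s / (Real.cos s * √(1 - ratio k a C s ^ 2))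
          = 1 / κ * (ratio k a C s * (κ / Real.cos s) / √(1 - ratio k a C s ^ 2)) := by
            field_simp
        _ ≤ 1 / κ * (ratio k a C s * (C * (1 / (Real.cos s ^ 2 * Real.sin s ^ k) -
              (k + 1) / Real.sin s ^ (k + 2)) + a / Real.cos s ^ 2) /
              √(1 - ratio k a C s ^ 2)) := by gcongr
        _ = _ := by
          set X := C * (1 / (Real.cos s ^ 2 * Real.sin s ^ k) -
              (k + 1) / Real.sin s ^ (k + 2)) + a / Real.cos s ^ 2
          field_simp
  rw [← integral_Ioc_eq_integral_Ioo, ← intervalIntegral.integral_of_le (hδ₁.trans hδ₂).le,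
    ← intervalIntegral.integral_add_adjacent_intervals hint₁ hint₂]
  exact add_le_add hleft hright

end SmallConstant

end Delaunay

/-! ### The width as a continuous function of C, and its values at the ends -/

namespace Delaunay

open Filter Topology

section Width

variable {n : ℕ} {h C : ℝ}

theorem R_eq_ratio_mul_L {k : ℕ} {s : ℝ} (hs : s ∈ Ioo 0 (Real.pi / 2)) :
    R (k + 3) h C s = ratio k (h / ((k : ℝ) + 2)) C s * L (k + 3) s := by
  have h1 := sin_pos_of_mem hs
  have h2 := cos_pos_of_mem hs
  unfold R ratio L
  rw [Real.tan_eq_sin_div_cos]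
  simp only [show k + 3 - 1 = k + 2 from rfl, show k + 3 - 2 = k + 1 from rfl]
  push_cast
  rw [show (k : ℝ) + 3 - 1 = k + 2 by ring]
  field_simp
  ring

theorem phaseDeriv_eq_ratio {k : ℕ} {s : ℝ} (hs : s ∈ Ioo 0 (Real.pi / 2)) :
    phaseDeriv (k + 3) h C s = ratio k (h / ((k : ℝ) + 2)) C s /
      (Real.cos s * √(1 - ratio k (h / ((k : ℝ) + 2)) C s ^ 2)) := by
  have h1 := L_pos (n := k + 3) hs
  have h2 : Real.cos s ^ 2 * Real.sin s ^ (2 * (k + 3 - 2)) - R (k + 3) h C s ^ 2 =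
      L (k + 3) s ^ 2 * (1 - ratio k (h / ((k : ℝ) + 2)) C s ^ 2) := by
    rw [R_eq_ratio_mul_L hs, mul_comm 2, pow_mul]; unfold L; ring
  unfold phaseDeriv
  rw [h2, Real.sqrt_mul (by positivity), Real.sqrt_sq h1.le, R_eq_ratio_mul_L hs,
    mul_comm (ratio _ _ _ _), mul_left_comm, mul_div_mul_left _ _ h1.ne']

/-- Data of the Morse coordinate `y` of `gap`, with inverse `S`. -/
structure IsGapCoordinate (n : ℕ) (h : ℝ) (y S : ℝ → ℝ) : Prop where
  contDiffOn : ContDiffOn ℝ ∞ y (Ioo 0 (Real.pi / 2))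
  gap_eq : ∀ s ∈ Ioo 0 (Real.pi / 2), gap n h s = contactConstant n h - y s ^ 2
  deriv_pos : ∀ s ∈ Ioo 0 (Real.pi / 2), 0 < deriv y s
  leftInv : ∀ s ∈ Ioo 0 (Real.pi / 2), S (y s) = s
  contact : y (contactPoint n h) = 0
  deriv_contact : deriv y (contactPoint n h) ^ 2 = Real.sin (contactPoint n h) ^ (n - 3) *
      (Real.tan (contactPoint n h) + ((n : ℝ) - 2) / Real.tan (contactPoint n h)) / 2

variable {y S : ℝ → ℝ}

theorem exists_isGapCoordinate (hn : 3 ≤ n) (hh : 0 < h) :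
    ∃ y S : ℝ → ℝ, IsGapCoordinate n h y S := by
  obtain ⟨y, S, h1, h2, h3, h4, h5, h6⟩ := exists_gap_coordinate hn hh
  exact ⟨y, S, h1, h2, h3, h6, h4, h5⟩

theorem J_eq_sublevel (hn : 3 ≤ n) (hh : 0 < h) (hy : IsGapCoordinate n h y S)
    (hC : C ∈ Ioo 0 (contactConstant n h)) :
    J n h C = {s | s ∈ Ioo 0 (Real.pi / 2) ∧ |y s| < √(contactConstant n h - C)} := by
  ext s
  rw [mem_J_iff hn hh hC.1]
  refine and_congr_right fun hs => ?_
  rw [hy.gap_eq s hs, Real.lt_sqrt (abs_nonneg _), sq_abs]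
  constructor <;> intro <;> linarith

theorem phaseDeriv_eq_coordinate (hn : 3 ≤ n) (hh : 0 < h) (hy : IsGapCoordinate n h y S)
    (hC : C ∈ Ioo 0 (contactConstant n h)) {s : ℝ} (hs : s ∈ Ioo 0 (Real.pi / 2)) :
    phaseDeriv n h C s =
      weight n h C s / √(√(contactConstant n h - C) ^ 2 - y s ^ 2) := by
  rw [phaseDeriv_eq_weight hn hh hC.1 hs, Real.sq_sqrt (by linarith [hC.2]), hy.gap_eq s hs,
    sub_right_comm]

theorem gapCoordinate_subset (hn : 3 ≤ n) (hh : 0 < h) (hy : IsGapCoordinate n h y S)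
    (hC : 0 < C) :
    Icc (-√(contactConstant n h - C)) (√(contactConstant n h - C)) ⊆ y '' Ioo 0 (Real.pi / 2) :=
  Icc_subset_image hn hh hy.contDiffOn hy.gap_eq hy.deriv_pos hy.contact hC

theorem J_eq_Ioo (hn : 3 ≤ n) (hh : 0 < h) (hy : IsGapCoordinate n h y S)
    (hC : C ∈ Ioo 0 (contactConstant n h)) :
    ∃ r₁ r₂, 0 < r₁ ∧ r₁ < r₂ ∧ r₂ < Real.pi / 2 ∧ J n h C = Ioo r₁ r₂ ∧
      gap n h r₁ = C ∧ gap n h r₂ = C := by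
  have hε : 0 < √(contactConstant n h - C) := Real.sqrt_pos.2 (by linarith [hC.2])
  have hsub := gapCoordinate_subset hn hh hy hC.1
  obtain ⟨h1, h2⟩ := sublevel_eq_Ioo hy.contDiffOn hy.deriv_pos hy.leftInv hε hsub
  obtain ⟨h3, h3'⟩ := leftInverse_image_mem hy.leftInv (hsub (left_mem_Icc.2 (by linarith)))
  obtain ⟨h4, h4'⟩ := leftInverse_image_mem hy.leftInv (hsub (right_mem_Icc.2 (by linarith)))
  refine ⟨_, _, h3.1, h2, h4.2, (J_eq_sublevel hn hh hy hC).trans h1, ?_, ?_⟩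
  · rw [hy.gap_eq _ h3, h3', neg_sq, Real.sq_sqrt (by linarith [hC.2])]; ring
  · rw [hy.gap_eq _ h4, h4', Real.sq_sqrt (by linarith [hC.2])]; ring

/-- The half width as an integral of a function which is regular up to `C = contactConstant`. -/
noncomputable def regularHalfWidth (n : ℕ) (h : ℝ) (y S : ℝ → ℝ) (C : ℝ) : ℝ :=
  ∫ φ in (0 : ℝ)..Real.pi, weight n h C (S (-√(contactConstant n h - C) * Real.cos φ)) /
    deriv y (S (-√(contactConstant n h - C) * Real.cos φ))

theorem integral_phaseDeriv (hn : 3 ≤ n) (hh : 0 < h) (hy : IsGapCoordinate n h y S)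
    (hC : C ∈ Ioo 0 (contactConstant n h)) :
    IntegrableOn (phaseDeriv n h C) (J n h C) ∧
      ∫ s in J n h C, phaseDeriv n h C s = regularHalfWidth n h y S C := by
  have hε : 0 < √(contactConstant n h - C) := Real.sqrt_pos.2 (by linarith [hC.2])
  obtain ⟨h1, h2⟩ := integral_regularization hy.contDiffOn hy.deriv_pos hy.leftInv hε
    (gapCoordinate_subset hn hh hy hC.1) (contDiffOn_weight hn hh hC.1).continuousOn
  rw [← J_eq_sublevel hn hh hy hC] at h1 h2
  obtain ⟨r₁, r₂, -, -, -, hJ, -⟩ := J_eq_Ioo hn hh hy hC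
  have hm : MeasurableSet (J n h C) := by rw [hJ]; exact measurableSet_Ioo
  have heq : EqOn (phaseDeriv n h C)
      (fun s => weight n h C s / √(√(contactConstant n h - C) ^ 2 - y s ^ 2)) (J n h C) :=
    fun s hs => phaseDeriv_eq_coordinate hn hh hy hC hs.1
  exact ⟨(integrableOn_congr_fun heq hm).2 h1, (setIntegral_congr_fun hm heq).trans h2⟩

/-- After the substitution the integrand is jointly continuous in (C, φ), also at C = C_h, where J
is empty and the original integral would give 0. -/
theorem continuous_regularHalfWidth (hn : 3 ≤ n) (hh : 0 < h) (hy : IsGapCoordinate n h y S) :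
    Continuous fun C : Ioc 0 (contactConstant n h) => regularHalfWidth n h y S C := by
  refine intervalIntegral.continuous_parametric_intervalIntegral_of_continuous' ?_ 0 Real.pi
  set g : Ioc 0 (contactConstant n h) × ℝ → ℝ :=
    fun p => S (-√(contactConstant n h - p.1) * Real.cos p.2) with hg
  have hz : ∀ p : Ioc 0 (contactConstant n h) × ℝ,
      -√(contactConstant n h - p.1) * Real.cos p.2 ∈ y '' Ioo 0 (Real.pi / 2) := by
    intro p
    refine gapCoordinate_subset hn hh hy p.1.2.1 ?_
    rw [neg_mul, mem_Icc, ← abs_le, abs_neg, abs_mul, abs_of_nonneg (Real.sqrt_nonneg _)]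
    exact mul_le_of_le_one_right (Real.sqrt_nonneg _) (Real.abs_cos_le_one _)
  have hgm : ∀ p, g p ∈ Ioo 0 (Real.pi / 2) := fun p => (leftInverse_image_mem hy.leftInv (hz p)).1
  have hgc : Continuous g := by
    have hSc : ContinuousOn S (y '' Ioo 0 (Real.pi / 2)) := by
      rintro _ ⟨s, hs, rfl⟩
      exact (contDiffAt_hasDerivAt_leftInverse isOpen_Ioo hy.contDiffOn hy.deriv_pos hy.leftInv
        hs).1.continuousAt.continuousWithinAt
    exact hSc.comp_continuous (by fun_prop) hz
  have hdy : Continuous fun p => deriv y (g p) :=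
    (hy.contDiffOn.continuousOn_deriv_of_isOpen isOpen_Ioo (by simp)).comp_continuous hgc hgm
  have hR : Continuous fun p : Ioc 0 (contactConstant n h) × ℝ => R n h p.1 (g p) := by
    unfold R; fun_prop
  have hL : Continuous fun p : Ioc 0 (contactConstant n h) × ℝ => L n (g p) := by
    unfold L; fun_prop
  refine Continuous.div (hR.div ((Real.continuous_cos.comp hgc).mul (hL.add hR).sqrt) ?_) hdy ?_
  · intro p
    have h1 := R_pos hn hh p.1.2.1 (hgm p)
    have h2 := L_pos (n := n) (hgm p)
    have h3 := cos_pos_of_mem (hgm p)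
    have h4 : 0 < √(L n (g p) + R n h p.1 (g p)) := Real.sqrt_pos.2 (by positivity)
    exact (mul_pos h3 h4).ne'
  · exact fun p => (hy.deriv_pos _ (hgm p)).ne'

/-- At C_h the integrand is the constant weight / y' at s_h. There R = L, so with t = tan s_h the
squared weight is sin^{n-3} t / 2, while y'² is sin^{n-3} (t + (n-2)/t) / 2. -/
theorem regularHalfWidth_contactConstant (hn : 3 ≤ n) (hh : 0 < h)
    (hy : IsGapCoordinate n h y S) :
    0 < regularHalfWidth n h y S (contactConstant n h) ∧
    regularHalfWidth n h y S (contactConstant n h) ^ 2 *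
      (1 + ((n : ℝ) - 2) / Real.tan (contactPoint n h) ^ 2) = Real.pi ^ 2 := by
  have hc := contactPoint_mem hn hh
  have hCpos := contactConstant_pos hn hh
  have ht := (tan_contactPoint hn hh).1
  have hn2 := sub_two_pos hn
  have hSc : S 0 = contactPoint n h := by rw [← hy.contact, hy.leftInv _ hc]
  have hdc := hy.deriv_contact
  have hd := hy.deriv_pos _ hc
  have hval : regularHalfWidth n h y S (contactConstant n h) = Real.pi *
      (weight n h (contactConstant n h) (contactPoint n h) / deriv y (contactPoint n h)) := by
    simp [regularHalfWidth, hSc, mul_div_assoc]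
  have hRL : R n h (contactConstant n h) (contactPoint n h) = L n (contactPoint n h) := by
    have := L_sub_R (n := n) (h := h) (C := contactConstant n h) (s := contactPoint n h)
    have h2 : gap n h (contactPoint n h) = contactConstant n h := rfl
    linarith
  have hw := weight_pos hn hh hCpos hc
  refine ⟨by rw [hval]; have := Real.pi_pos; positivity, ?_⟩
  have hL := L_pos (n := n) hc
  have hcos := cos_pos_of_mem hc
  have hsin := sin_pos_of_mem hc
  have hw2 : weight n h (contactConstant n h) (contactPoint n h) ^ 2 =
      L n (contactPoint n h) / (2 * Real.cos (contactPoint n h) ^ 2) := by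
    unfold weight
    rw [hRL, div_pow, mul_pow, Real.sq_sqrt (by positivity)]
    field_simp
    ring
  have hL2 : L n (contactPoint n h) = Real.cos (contactPoint n h) ^ 2 *
      (Real.sin (contactPoint n h) ^ (n - 3) * Real.tan (contactPoint n h)) := by
    obtain ⟨k, rfl⟩ := Nat.exists_eq_add_of_le' hn
    rw [Real.tan_eq_sin_div_cos]
    unfold L
    simp only [show k + 3 - 2 = k + 1 from rfl, Nat.add_sub_cancel]
    field_simp
    ring
  rw [hval, mul_pow, div_pow, hw2, hdc, hL2]
  have hp : 0 < Real.sin (contactPoint n h) ^ (n - 3) := by positivity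
  have h3 : 0 < (n : ℝ) - 2 + Real.tan (contactPoint n h) ^ 2 := by positivity
  field_simp

/-- The width is asymptotically at most `2 (n - 1) / h` for small `C`. -/
theorem exists_halfWidth_lt (hn : 3 ≤ n) (hh : 0 < h) (hy : IsGapCoordinate n h y S) {M : ℝ}
    (hM : ((n : ℝ) - 1) / h < M) :
    ∃ C ∈ Ioo 0 (contactConstant n h), regularHalfWidth n h y S C < M := by
  obtain ⟨k, rfl⟩ := Nat.exists_eq_add_of_le' hn
  set a := h / ((k : ℝ) + 2) with ha
  have hk2 : (0 : ℝ) < (k : ℝ) + 2 := by positivity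
  have hapos : 0 < a := by positivity
  have hM' : 1 / a < M := by
    rw [ha, one_div_div]; push_cast at hM
    rwa [show (k : ℝ) + 3 - 1 = k + 2 by ring] at hM
  set d := M - 1 / a with hd
  have hdpos : 0 < d := by linarith
  -- 1/κ is the midpoint of 1/a and M; the remaining d/2 is left for the part near the left end.
  set κ := 1 / (1 / a + d / 2) with hκ
  have hκpos : 0 < κ := by positivity
  have hκa : κ < a := by
    rw [hκ, div_lt_iff₀ (by positivity), mul_add, mul_one_div_cancel hapos.ne']
    have : 0 < a * (d / 2) := by positivity
    linarith
  -- δ is fixed before C: it makes the left part less than d/2 and one term of the ratio at δ less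
  -- than 1/4. A small C then makes the other term less than 1/4 and secures the slope bound κ
  -- beyond δ.
  obtain ⟨δ, hδ, hδ1, hδ2⟩ : ∃ δ ∈ Ioo 0 (Real.pi / 2),
      2 * √(2 * δ) * √δ / Real.cos δ < d / 2 ∧ a * Real.tan δ < 1 / 4 := by
    have h1 : ∀ᶠ δ in 𝓝 (0 : ℝ), 2 * √(2 * δ) * √δ / Real.cos δ < d / 2 := by
      have : ContinuousAt (fun δ : ℝ => 2 * √(2 * δ) * √δ / Real.cos δ) 0 :=
        ContinuousAt.div (by fun_prop) (by fun_prop) (by simp)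
      exact this.eventually (gt_mem_nhds (by simpa using hdpos))
    have h2 : ∀ᶠ δ in 𝓝 (0 : ℝ), a * Real.tan δ < 1 / 4 := by
      have : ContinuousAt (fun δ : ℝ => a * Real.tan δ) 0 :=
        continuousAt_const.mul (Real.continuousAt_tan.2 (by simp))
      exact this.eventually (gt_mem_nhds (by simp))
    have h3 : ∀ᶠ s in 𝓝[>] (0 : ℝ), s ∈ Ioo 0 (Real.pi / 2) :=
      Ioo_mem_nhdsGT (by linarith [Real.pi_pos])
    exact (h3.and ((h1.and h2).filter_mono nhdsWithin_le_nhds)).exists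
  have hs := sin_pos_of_mem hδ
  have hc := cos_pos_of_mem hδ
  obtain ⟨C, hC, hC1, hC2⟩ : ∃ C ∈ Ioo 0 (contactConstant (k + 3) h),
      C / (Real.cos δ * Real.sin δ ^ (k + 1)) < 1 / 4 ∧
        C * (k + 1) / Real.sin δ ^ (k + 2) < a - κ := by
    have h1 : ∀ᶠ C in 𝓝 (0 : ℝ), C / (Real.cos δ * Real.sin δ ^ (k + 1)) < 1 / 4 := by
      have : ContinuousAt (fun C : ℝ => C / (Real.cos δ * Real.sin δ ^ (k + 1))) 0 := by fun_prop
      exact this.eventually (gt_mem_nhds (by simp))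
    have h2 : ∀ᶠ C in 𝓝 (0 : ℝ), C * (k + 1) / Real.sin δ ^ (k + 2) < a - κ := by
      have : ContinuousAt (fun C : ℝ => C * (k + 1) / Real.sin δ ^ (k + 2)) 0 := by fun_prop
      exact this.eventually (gt_mem_nhds (by simpa using hκa))
    have h3 : ∀ᶠ s in 𝓝[>] (0 : ℝ), s ∈ Ioo 0 (contactConstant (k + 3) h) :=
      Ioo_mem_nhdsGT (contactConstant_pos hn hh)
    exact (h3.and ((h1.and h2).filter_mono nhdsWithin_le_nhds)).exists
  refine ⟨C, hC, ?_⟩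
  obtain ⟨hi, hiw⟩ := integral_phaseDeriv hn hh hy hC
  obtain ⟨r₁, r₂, hr₁, hr, hr₂, hJ, hg₁, hg₂⟩ := J_eq_Ioo hn hh hy hC
  -- With c = 1 this says that 1 - ratio has the sign of `gap` - C.
  have hratio : ∀ s ∈ Ioo 0 (Real.pi / 2), ∀ c : ℝ,
      L (k + 3) s * (c - ratio k a C s) = (gap (k + 3) h s - C) - L (k + 3) s * (1 - c) := by
    intro s hs c
    rw [← L_sub_R, R_eq_ratio_mul_L hs]; ring
  have hone : ∀ s ∈ Ioo 0 (Real.pi / 2), gap (k + 3) h s = C → ratio k a C s = 1 := by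
    intro s hs hgs
    have h1 := hratio s hs 1
    have h2 := (L_pos (n := k + 3) hs).ne'
    rw [hgs, sub_self, sub_self, mul_zero, sub_zero, mul_eq_zero, or_iff_right h2] at h1
    linarith
  have hlt : ∀ s ∈ J (k + 3) h C, ratio k a C s < 1 := by
    intro s hs
    obtain ⟨hsI, hs2⟩ := (mem_J_iff hn hh hC.1).1 hs
    have h1 := hratio s hsI 1
    rw [sub_self, mul_zero, sub_zero] at h1
    have := pos_of_mul_pos_right (h1 ▸ (by linarith : 0 < gap (k + 3) h s - C))
      (L_pos (n := k + 3) hsI).le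
    linarith
  have hδr : ratio k a C δ ≤ 1 / 2 := by unfold ratio; linarith
  have hδJ : δ ∈ J (k + 3) h C := by
    rw [mem_J_iff hn hh hC.1]
    refine ⟨hδ, ?_⟩
    have h1 := hratio δ hδ 1
    rw [sub_self, mul_zero, sub_zero] at h1
    have := mul_pos (L_pos (n := k + 3) hδ) (by linarith : 0 < 1 - ratio k a C δ)
    linarith
  rw [hJ] at hδJ hlt hi hiw
  rw [← hiw]
  have key := integral_ratio_le hC.1 hapos hr₁ hδJ.1 hδJ.2 hr₂
    (hone _ ⟨hr₁, hr.trans hr₂⟩ hg₁) (hone _ ⟨hr₁.trans hr, hr₂⟩ hg₂) hlt hδr hκpos (by linarith) hi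
    (fun s hs => phaseDeriv_eq_ratio ⟨hr₁.trans hs.1, hs.2.trans hr₂⟩)
  have h1κ : 1 / κ = 1 / a + d / 2 := by rw [hκ, one_div_one_div]
  linarith

/-- The width `2π / k` is attained. -/
theorem exists_width_eq (hn : 3 ≤ n) {k : ℤ} (hk : 2 < k) (hZ : h ∈ Z n k)
    (hy : IsGapCoordinate n h y S) (hh : 0 < h) :
    ∃ C ∈ Ioo 0 (contactConstant n h), regularHalfWidth n h y S C = Real.pi / k := by
  have hk2 : (2 : ℝ) < k := by exact_mod_cast hk
  have hn2 := sub_two_pos hn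
  have hn1 := sub_one_pos hn
  have hπ := Real.pi_pos
  have hCpos := contactConstant_pos hn hh
  obtain ⟨C₁, hC₁, hlt⟩ := exists_halfWidth_lt hn hh hy (M := Real.pi / k) (by
    have := hZ.1
    rw [div_lt_iff₀ hπ] at this
    rw [div_lt_div_iff₀ hh (by linarith)]
    linarith)
  obtain ⟨ht, hteq⟩ := tan_contactPoint hn hh
  obtain ⟨hwpos, hweq⟩ := regularHalfWidth_contactConstant hn hh hy
  have hgt : Real.pi / k < regularHalfWidth n h y S (contactConstant n h) := by
    set t := Real.tan (contactPoint n h)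
    set m := (n : ℝ) - 2
    have hk1 : (0 : ℝ) < (k : ℝ) ^ 2 - 1 := by nlinarith
    -- The right end of Z(k) is the value of the decreasing function τ ↦ m/τ - τ at z = √(m/(k² -
    -- 1)), and h is its value at t. So h below that end means t > z.
    have hk3 : 1 + m / t ^ 2 < (k : ℝ) ^ 2 := by
      by_contra! hcon
      set z := √(m / ((k : ℝ) ^ 2 - 1)) with hz
      have hz0 : 0 < z := Real.sqrt_pos.2 (by positivity)
      have hz2 : z ^ 2 * ((k : ℝ) ^ 2 - 1) = m := by
        rw [hz, Real.sq_sqrt (by positivity)]; field_simp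
      have h1 : t ≤ z := by
        have h2 : t ^ 2 * ((k : ℝ) ^ 2 - 1) ≤ m := by
          have h3 : (k : ℝ) ^ 2 - 1 ≤ m / t ^ 2 := by linarith
          rw [le_div_iff₀ (by positivity)] at h3; linarith
        have h3 : t ^ 2 ≤ z ^ 2 := by
          rw [← hz2] at h2; exact le_of_mul_le_mul_right h2 hk1
        exact (pow_le_pow_iff_left₀ ht.le hz0.le two_ne_zero).1 h3
      have h4 : ((k : ℝ) ^ 2 - 2) * z = m / z - z := by
        rw [← hz2]; field_simp; ring
      have h5 : m / z ≤ m / t := by gcongr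
      have h6 := hZ.2
      change h < ((k : ℝ) ^ 2 - 2) * z at h6
      linarith
    set w := regularHalfWidth n h y S (contactConstant n h)
    rw [div_lt_iff₀ (by linarith)]
    have h7 : 0 < w ^ 2 := by positivity
    have h8 : Real.pi ^ 2 < (w * k) ^ 2 := by
      rw [← hweq, mul_pow]; exact mul_lt_mul_of_pos_left hk3 h7
    have h9 : 0 < w * k := mul_pos hwpos (by linarith)
    exact (pow_lt_pow_iff_left₀ hπ.le h9.le two_ne_zero).1 h8
  -- The intermediate value theorem is used on the half-open interval; the endpoint C_h is excluded
  -- afterwards by the strict inequality there.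
  have : PreconnectedSpace (Ioc 0 (contactConstant n h)) :=
    Subtype.preconnectedSpace isPreconnected_Ioc
  obtain ⟨⟨C, hC⟩, hCeq⟩ := mem_range_of_exists_le_of_exists_ge
    (continuous_regularHalfWidth hn hh hy)
    ⟨⟨C₁, hC₁.1, hC₁.2.le⟩, hlt.le⟩ ⟨⟨_, hCpos, le_rfl⟩, hgt.le⟩
  refine ⟨C, ⟨hC.1, lt_of_le_of_ne hC.2 ?_⟩, hCeq⟩
  rintro rfl
  exact hgt.ne' hCeq

theorem pos_of_mem_Z (hn : 3 ≤ n) {k : ℤ} (hk : 2 < k) (hZ : h ∈ Z n k) : 0 < h := by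
  have hk2 : (2 : ℝ) < k := by exact_mod_cast hk
  have hn1 := sub_one_pos hn
  have hπ := Real.pi_pos
  refine lt_trans ?_ hZ.1
  have : (0 : ℝ) < k := by linarith
  positivity

/-- Divided by k, the ends of Z(k) are (n-1)/π and a quantity tending to √(n-2). The inequality
(n-1)² < (n-2)π² holds up to n = 9, where 3.14 is already a good enough bound for π, and fails at n
= 10. -/
theorem infinite_nonempty_Z (hn : 3 ≤ n) (hn9 : n ≤ 9) :
    {k : ℤ | 2 < k ∧ (Z n k).Nonempty}.Infinite := by
  have hq : ((n : ℝ) - 1) / Real.pi < √((n : ℝ) - 2) := by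
    have hn1 := sub_one_pos hn
    have hn2 := sub_two_pos hn
    rw [Real.lt_sqrt (by have := Real.pi_pos; positivity), div_pow, div_lt_iff₀ (by positivity)]
    have h1 : (3.14 : ℝ) ^ 2 < Real.pi ^ 2 := by
      have := Real.pi_gt_d2
      gcongr
    have h2 : ((n : ℝ) - 2) * 3.14 ^ 2 < ((n : ℝ) - 2) * Real.pi ^ 2 := by gcongr
    refine lt_trans ?_ h2
    interval_cases n <;> norm_num
  have hev : ∀ᶠ k : ℕ in atTop, 2 < k ∧ (Z n (k : ℤ)).Nonempty := by
    have hlim : Tendsto (fun k : ℕ => (((k : ℝ) ^ 2 - 2) * √(((n : ℝ) - 2) / ((k : ℝ) ^ 2 - 1))) / k)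
        atTop (𝓝 (√((n : ℝ) - 2))) := by
      have h0 : Tendsto (fun k : ℕ => ((k : ℝ))⁻¹) atTop (𝓝 0) := tendsto_inv_atTop_nhds_zero_nat
      have h1 : Tendsto (fun k : ℕ => (1 - 2 * ((k : ℝ))⁻¹ ^ 2) *
          √(((n : ℝ) - 2) / (1 - ((k : ℝ))⁻¹ ^ 2))) atTop
          (𝓝 ((1 - 2 * 0 ^ 2) * √(((n : ℝ) - 2) / (1 - 0 ^ 2)))) := by
        refine (tendsto_const_nhds.sub ((h0.pow 2).const_mul 2)).mul
          (Tendsto.sqrt (tendsto_const_nhds.div (tendsto_const_nhds.sub (h0.pow 2)) (by norm_num)))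
      rw [show (1 - 2 * 0 ^ 2) * √(((n : ℝ) - 2) / (1 - 0 ^ 2)) = √((n : ℝ) - 2) by norm_num] at h1
      refine h1.congr' ?_
      filter_upwards [eventually_gt_atTop 2] with k hk
      have hk2 : (2 : ℝ) < k := by exact_mod_cast hk
      have hk0 : (0 : ℝ) < k := by linarith
      have e1 : ((n : ℝ) - 2) / (1 - ((k : ℝ))⁻¹ ^ 2) =
          (k : ℝ) ^ 2 * (((n : ℝ) - 2) / ((k : ℝ) ^ 2 - 1)) := by
        have : (k : ℝ) ^ 2 - 1 ≠ 0 := by nlinarith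
        have h3 : 1 - ((k : ℝ))⁻¹ ^ 2 = ((k : ℝ) ^ 2 - 1) / (k : ℝ) ^ 2 := by field_simp
        rw [h3, div_div_eq_mul_div]; ring
      rw [e1, Real.sqrt_mul (by positivity), Real.sqrt_sq hk0.le]
      field_simp
    filter_upwards [eventually_gt_atTop 2, hlim.eventually (lt_mem_nhds hq)] with k hk hk'
    refine ⟨hk, ?_⟩
    have hk0 : (0 : ℝ) < k := by exact_mod_cast (by omega : 0 < k)
    rw [Z, nonempty_Ioo]
    rw [lt_div_iff₀ hk0] at hk'
    refine lt_of_eq_of_lt ?_ (by exact_mod_cast hk')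
    push_cast
    ring
  obtain ⟨N, hN⟩ := eventually_atTop.1 hev
  refine Set.infinite_of_not_bddAbove fun ⟨b, hb⟩ => ?_
  have h1 := hN (max N (b.toNat + 1)) (le_max_left _ _)
  have h2 := hb (show ((max N (b.toNat + 1) : ℕ) : ℤ) ∈ _ from ⟨by exact_mod_cast h1.1, h1.2⟩)
  have h3 : b.toNat + 1 ≤ max N (b.toNat + 1) := le_max_right _ _
  omega

end Width

end Delaunay

/-! ### Rotational charts in polar coordinates and their mean curvature -/

namespace Delaunay

open Filter Topology

section PolarMap

variable {m : ℕ}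

/-- Rotational maps in polar coordinates: the logarithm of the radius is the curve parameter. -/
noncomputable def polarMap (P : ℝ → ℂ) (q : ℝ → ℝ) (w : EuclideanSpace ℝ (Fin m)) :
    WithLp 2 (ℂ × EuclideanSpace ℝ (Fin m)) :=
  WithLp.toLp 2 (P (Real.log ‖w‖), q (Real.log ‖w‖) • w)

variable {P Q : ℝ → ℂ} {p q : ℝ → ℝ} {w : EuclideanSpace ℝ (Fin m)}

theorem hasFDerivAt_log_norm (hw : w ≠ 0) :
    HasFDerivAt (fun w : EuclideanSpace ℝ (Fin m) => Real.log ‖w‖)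
      ((‖w‖ ^ 2)⁻¹ • innerSL ℝ w) w := by
  have h1 : HasFDerivAt (fun w : EuclideanSpace ℝ (Fin m) => ‖w‖ ^ 2) (2 • innerSL ℝ w) w :=
    (hasStrictFDerivAt_norm_sq w).hasFDerivAt
  have hn : ‖w‖ ≠ 0 := norm_ne_zero_iff.2 hw
  have h2 := (h1.log (pow_ne_zero 2 hn)).const_mul (1 / 2)
  refine (h2.congr_fderiv ?_).congr_of_eventuallyEq (Eventually.of_forall fun x => ?_)
  · ext v
    simp
    ring
  · simp

theorem contDiffAt_log_norm (hw : w ≠ 0) :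
    ContDiffAt ℝ ∞ (fun w : EuclideanSpace ℝ (Fin m) => Real.log ‖w‖) w :=
  (contDiffAt_norm ℝ hw).log (norm_ne_zero_iff.2 hw)

theorem contDiffAt_polarMap (hP : ContDiff ℝ ∞ P) (hq : ContDiff ℝ ∞ q) (hw : w ≠ 0) :
    ContDiffAt ℝ ∞ (polarMap P q) w := by
  have h1 := contDiffAt_log_norm hw
  have h2 : ContDiffAt ℝ ∞ (fun w : EuclideanSpace ℝ (Fin m) =>
      (P (Real.log ‖w‖), q (Real.log ‖w‖) • w)) w :=
    (hP.contDiffAt.comp w h1).prodMk ((hq.contDiffAt.comp w h1).smul contDiffAt_id)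
  exact (WithLp.prodContinuousLinearEquiv 2 ℝ ℂ (EuclideanSpace ℝ (Fin m))).symm.contDiff.contDiffAt.comp w h2

theorem fderiv_polarMap (hP : DifferentiableAt ℝ P (Real.log ‖w‖))
    (hq : DifferentiableAt ℝ q (Real.log ‖w‖)) (hw : w ≠ 0) (v : EuclideanSpace ℝ (Fin m)) :
    fderiv ℝ (polarMap P q) w v =
      WithLp.toLp 2 ((inner ℝ w v / ‖w‖ ^ 2) • deriv P (Real.log ‖w‖),
        q (Real.log ‖w‖) • v + (inner ℝ w v / ‖w‖ ^ 2 * deriv q (Real.log ‖w‖)) • w) := by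
  have h1 := hasFDerivAt_log_norm hw
  have h2 := hP.hasDerivAt.hasFDerivAt.comp w h1
  have h3 := hq.hasDerivAt.hasFDerivAt.comp w h1
  have h4 := h2.prodMk (h3.smul (hasFDerivAt_id w))
  have h5 := (WithLp.prodContinuousLinearEquiv 2 ℝ ℂ
    (EuclideanSpace ℝ (Fin m))).symm.toContinuousLinearMap.hasFDerivAt.comp w h4
  have h6 : HasFDerivAt (polarMap P q) _ w := h5
  rw [h6.fderiv]
  simp [div_eq_inv_mul, mul_assoc]

theorem inner_toLp (z z' : ℂ) (x x' : EuclideanSpace ℝ (Fin m)) :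
    inner ℝ (WithLp.toLp 2 (z, x)) (WithLp.toLp 2 (z', x')) = inner ℝ z z' + inner ℝ x x' := by
  simp [WithLp.prod_inner_apply]

/-- Second derivatives paired with a normal field. -/
theorem inner_fderiv_fderiv {V E : Type*} [NormedAddCommGroup V] [NormedSpace ℝ V]
    [NormedAddCommGroup E] [InnerProductSpace ℝ E] {f N : V → E} {u : V}
    (hf : ContDiffAt ℝ ∞ f u) (hN : DifferentiableAt ℝ N u)
    (horth : ∀ᶠ w in 𝓝 u, ∀ v, inner ℝ (fderiv ℝ f w v) (N w) = 0) (v v' : V) :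
    inner ℝ (fderiv ℝ (fderiv ℝ f) u v v') (N u) =
      -inner ℝ (fderiv ℝ f u v') (fderiv ℝ N u v) := by
  have h1 : DifferentiableAt ℝ (fderiv ℝ f) u :=
    (hf.fderiv_right (m := ∞) (by simp)).differentiableAt (by simp)
  have h2 : HasFDerivAt (fun w => fderiv ℝ f w v')
      ((ContinuousLinearMap.apply ℝ E v').comp (fderiv ℝ (fderiv ℝ f) u)) u :=
    (ContinuousLinearMap.apply ℝ E v').hasFDerivAt.comp u h1.hasFDerivAt
  -- The identity comes from differentiating ⟨Df v', N⟩ = 0 in the direction v.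
  have h3 := h2.inner ℝ hN.hasFDerivAt
  have h4 : HasFDerivAt (fun w => inner ℝ (fderiv ℝ f w v') (N w)) (0 : V →L[ℝ] ℝ) u :=
    (hasFDerivAt_const (0 : ℝ) u).congr_of_eventuallyEq (by
      filter_upwards [horth] with w hw using hw v')
  have h5 := DFunLike.congr_fun (h3.unique h4) v
  simp at h5
  linarith

/-- G and H are combinations of the complementary projections Q = x xᵀ and 1 - Q, so inverse and
product act on coefficients; the traces of the projections are 1 and m - 1. -/
theorem trace_projection_mul {x : EuclideanSpace ℝ (Fin m)} (hx : ‖x‖ = 1) {α β γ δ : ℝ}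
    (hα : α ≠ 0) (hβ : β ≠ 0) {G H : Matrix (Fin m) (Fin m) ℝ}
    (hG : ∀ i j, G i j = α * (x i * x j) + β * ((if i = j then 1 else 0) - x i * x j))
    (hH : ∀ i j, H i j = γ * (x i * x j) + δ * ((if i = j then 1 else 0) - x i * x j)) :
    (G⁻¹ * H).trace = γ / α + ((m : ℝ) - 1) * (δ / β) := by
  set Q : Matrix (Fin m) (Fin m) ℝ := Matrix.vecMulVec x x with hQ
  have hxx : (x : Fin m → ℝ) ⬝ᵥ x = 1 := by
    have := EuclideanSpace.real_norm_sq_eq x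
    rw [hx] at this
    simp only [dotProduct, ← pow_two]
    linarith
  have hQQ : Q * Q = Q := by
    rw [hQ, Matrix.vecMulVec_mul_vecMulVec, hxx]
    simp
  have hQt : Q.trace = 1 := by rw [hQ, Matrix.trace_vecMulVec, hxx]
  have hG' : G = α • Q + β • (1 - Q) := by
    ext i j; simp [hG, hQ, Matrix.vecMulVec_apply, Matrix.one_apply]
  have hH' : H = γ • Q + δ • (1 - Q) := by
    ext i j; simp [hH, hQ, Matrix.vecMulVec_apply, Matrix.one_apply]
  have hmul : ∀ s t s' t' : ℝ, (s • Q + t • (1 - Q)) * (s' • Q + t' • (1 - Q)) =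
      (s * s') • Q + (t * t') • (1 - Q) := by
    intro s t s' t'
    have e1 : Q * (1 - Q) = 0 := by rw [mul_sub, hQQ, mul_one, sub_self]
    have e2 : (1 - Q) * Q = 0 := by rw [sub_mul, hQQ, one_mul, sub_self]
    have e3 : (1 - Q) * (1 - Q) = 1 - Q := by rw [mul_sub, e2, mul_one, sub_zero]
    rw [add_mul, mul_add, mul_add]
    simp only [Matrix.smul_mul, Matrix.mul_smul, hQQ, e1, e2, e3, smul_zero, add_zero, zero_add,
      smul_smul]
    rw [mul_comm s s', mul_comm t t']
  have hinv : G⁻¹ = α⁻¹ • Q + β⁻¹ • (1 - Q) := by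
    refine Matrix.inv_eq_right_inv ?_
    rw [hG', hmul, mul_inv_cancel₀ hα, mul_inv_cancel₀ hβ]
    simp
  rw [hinv, hH', hmul, Matrix.trace_add, Matrix.trace_smul, Matrix.trace_smul, Matrix.trace_sub,
    hQt, Matrix.trace_one, Fintype.card_fin]
  simp only [smul_eq_mul]
  field_simp

variable {A B : ℝ → ℂ} {b c : ℝ → ℝ} {t : ℝ}

/-- The rotational chart which sends the unit vector `x` to the point `(A t, b t x)`. -/
noncomputable def rotChart (A : ℝ → ℂ) (b : ℝ → ℝ) (t : ℝ) :
    EuclideanSpace ℝ (Fin m) → WithLp 2 (ℂ × EuclideanSpace ℝ (Fin m)) :=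
  polarMap (fun τ => A (t + τ)) (fun τ => b (t + τ) * Real.exp (-τ))

theorem contDiffAt_rotChart (hA : ContDiff ℝ ∞ A) (hb : ContDiff ℝ ∞ b) (hw : w ≠ 0) :
    ContDiffAt ℝ ∞ (rotChart A b t) w :=
  contDiffAt_polarMap (hA.comp (contDiff_const.add contDiff_id))
    ((hb.comp (contDiff_const.add contDiff_id)).mul (Real.contDiff_exp.comp contDiff_neg)) hw

theorem rotChart_apply (hw : w ≠ 0) : rotChart A b t w =
    WithLp.toLp 2 (A (t + Real.log ‖w‖), b (t + Real.log ‖w‖) • (‖w‖⁻¹ • w)) := by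
  rw [rotChart, polarMap, Real.exp_neg, Real.exp_log (norm_pos_iff.2 hw), smul_smul]

theorem fderiv_rotChart (hA : Differentiable ℝ A) (hb : Differentiable ℝ b) (hw : w ≠ 0)
    (v : EuclideanSpace ℝ (Fin m)) :
    fderiv ℝ (rotChart A b t) w v =
      WithLp.toLp 2 ((inner ℝ w v / ‖w‖ ^ 2) • deriv A (t + Real.log ‖w‖),
        (b (t + Real.log ‖w‖) * ‖w‖⁻¹) • v + (inner ℝ w v / ‖w‖ ^ 2 *
          ((deriv b (t + Real.log ‖w‖) - b (t + Real.log ‖w‖)) * ‖w‖⁻¹)) • w) := by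
  have hlin : ∀ τ, HasDerivAt (fun τ : ℝ => t + τ) 1 τ := fun τ => (hasDerivAt_id τ).const_add t
  have hA' : ∀ τ, HasDerivAt (fun τ => A (t + τ)) (deriv A (t + τ)) τ := fun τ => by
    simpa [Function.comp_def] using (hA (t + τ)).hasDerivAt.scomp τ (hlin τ)
  have hb' : ∀ τ, HasDerivAt (fun τ => b (t + τ)) (deriv b (t + τ)) τ := fun τ => by
    simpa [Function.comp_def] using (hb (t + τ)).hasDerivAt.comp τ (hlin τ)
  have hq : ∀ τ, HasDerivAt (fun τ => b (t + τ) * Real.exp (-τ))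
      ((deriv b (t + τ) - b (t + τ)) * Real.exp (-τ)) τ := fun τ =>
    ((hb' τ).mul (hasDerivAt_neg τ).exp).congr_deriv (by ring)
  rw [rotChart, fderiv_polarMap (hA' _).differentiableAt (hq _).differentiableAt hw,
    (hA' _).deriv, (hq _).deriv, Real.exp_neg, Real.exp_log (norm_pos_iff.2 hw)]

/-- A normal (B, c) of the generating curve rotates to the normal (B, c x), which is itself a
`rotChart`. The normal field therefore has a derivative of the same form as the chart. -/
theorem inner_fderiv_rotChart_normal (hA : Differentiable ℝ A) (hb : Differentiable ℝ b)
    (horth : ∀ θ, inner ℝ (deriv A θ) (B θ) + deriv b θ * c θ = 0) (hw : w ≠ 0)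
    (v : EuclideanSpace ℝ (Fin m)) :
    inner ℝ (fderiv ℝ (rotChart A b t) w v) (rotChart B c t w) = 0 := by
  have hn := norm_pos_iff.2 hw
  rw [fderiv_rotChart hA hb hw, rotChart_apply hw, inner_toLp]
  simp only [inner_add_left, inner_smul_left, inner_smul_right, real_inner_self_eq_norm_sq,
    RCLike.conj_to_real, real_inner_comm w v]
  have h := horth (t + Real.log ‖w‖)
  rw [eq_neg_of_add_eq_zero_left h]
  field_simp
  ring

/-- At a unit vector x, where log ‖x‖ = 0, both fundamental forms are diagonal for the splitting
into the radial direction x, which is the profile direction, and its complement. The second form is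
obtained as -⟨Dφ, DN⟩, so only first derivatives of the two charts enter. -/
theorem meanCurvature_rotChart (hA : ContDiff ℝ ∞ A) (hb : ContDiff ℝ ∞ b)
    (hB : ContDiff ℝ ∞ B) (hc : ContDiff ℝ ∞ c)
    (horth : ∀ θ, inner ℝ (deriv A θ) (B θ) + deriv b θ * c θ = 0)
    {x : EuclideanSpace ℝ (Fin m)} (hx : ‖x‖ = 1) (hbt : b t ≠ 0)
    (hreg : ‖deriv A t‖ ^ 2 + deriv b t ^ 2 ≠ 0) :
    meanCurvature (rotChart A b t) (rotChart B c t x) x =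
      -(inner ℝ (deriv A t) (deriv B t) + deriv b t * deriv c t) /
        (‖deriv A t‖ ^ 2 + deriv b t ^ 2) + ((m : ℝ) - 1) * (-(c t) / b t) := by
  have hx0 : x ≠ 0 := by rintro rfl; simp at hx
  have hdA := hA.differentiable (by simp)
  have hdb := hb.differentiable (by simp)
  have hdB := hB.differentiable (by simp)
  have hdc := hc.differentiable (by simp)
  have hform : ∀ {A : ℝ → ℂ} {b : ℝ → ℝ}, Differentiable ℝ A → Differentiable ℝ b → ∀ i,
      fderiv ℝ (rotChart A b t) x (EuclideanSpace.single i 1) =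
        WithLp.toLp 2 (x i • deriv A t,
          b t • EuclideanSpace.single i 1 + (x i * (deriv b t - b t)) • x) := by
    intro A b hA hb i
    rw [fderiv_rotChart hA hb hx0, hx, EuclideanSpace.inner_single_right]
    simp
  have hcross : ∀ {A B : ℝ → ℂ} {b c : ℝ → ℝ} (i j : Fin m), inner ℝ
      (WithLp.toLp 2 (x i • deriv A t,
          b t • EuclideanSpace.single i 1 + (x i * (deriv b t - b t)) • x))
      (WithLp.toLp 2 (x j • deriv B t,
          c t • EuclideanSpace.single j 1 + (x j * (deriv c t - c t)) • x)) =
      (inner ℝ (deriv A t) (deriv B t) + deriv b t * deriv c t) * (x i * x j) +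
        b t * c t * ((if i = j then 1 else 0) - x i * x j) := by
    intro A B b c i j
    rw [inner_toLp]
    have e1 : inner ℝ (EuclideanSpace.single i (1 : ℝ)) (EuclideanSpace.single j (1 : ℝ)) =
        if i = j then (1 : ℝ) else 0 := by
      rw [EuclideanSpace.inner_single_left]; simp
    have e2 : ∀ i, inner ℝ (EuclideanSpace.single i (1 : ℝ)) x = x i := by
      intro i; rw [EuclideanSpace.inner_single_left]; simp
    have e3 : ∀ i, inner ℝ x (EuclideanSpace.single i (1 : ℝ)) = x i := by
      intro i; rw [EuclideanSpace.inner_single_right]; simp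
    simp only [inner_add_left, inner_add_right, inner_smul_left, inner_smul_right, e1, e2, e3,
      real_inner_self_eq_norm_sq, hx, RCLike.conj_to_real]
    ring
  have hsecond : ∀ i j, secondFundamentalForm (rotChart A b t) (rotChart B c t x) x i j =
      -(inner ℝ (deriv A t) (deriv B t) + deriv b t * deriv c t) * (x i * x j) +
        -(b t * c t) * ((if i = j then 1 else 0) - x i * x j) := by
    intro i j
    have h1 := inner_fderiv_fderiv (f := rotChart A b t) (N := rotChart B c t) (u := x)
      (contDiffAt_rotChart hA hb hx0)
      ((contDiffAt_rotChart hB hc hx0).differentiableAt (by simp))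
      (by filter_upwards [isOpen_ne.mem_nhds hx0] with w hw v using
        inner_fderiv_rotChart_normal hdA hdb horth hw v)
      (EuclideanSpace.single i 1) (EuclideanSpace.single j 1)
    rw [secondFundamentalForm, Matrix.of_apply, h1, hform hdA hdb, hform hdB hdc, hcross]
    simp only [eq_comm (a := j) (b := i)]
    ring
  have hfirst : ∀ i j, firstFundamentalForm (rotChart A b t) x i j =
      (‖deriv A t‖ ^ 2 + deriv b t ^ 2) * (x i * x j) +
        b t ^ 2 * ((if i = j then 1 else 0) - x i * x j) := by
    intro i j
    rw [firstFundamentalForm, Matrix.of_apply, hform hdA hdb, hform hdA hdb, hcross,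
      real_inner_self_eq_norm_sq]
    ring
  rw [meanCurvature, trace_projection_mul hx hreg (pow_ne_zero 2 hbt) hfirst hsecond]
  field_simp

end PolarMap

end Delaunay

/-! ### Rotational hypersurfaces of closed curves -/

namespace Delaunay

open Filter Topology

section Rotational

/-- Although the argument jumps, a 2π-periodic f does not see the jump; continuity descends along
the open quotient map `Circle.exp`. -/
theorem circle_lift {X : Type*} [TopologicalSpace X] {f : ℝ → X} (hf : Continuous f)
    (hper : Function.Periodic f (2 * Real.pi)) :
    Continuous (fun z : Circle => f (Complex.arg z)) ∧
      ∀ θ, f (Complex.arg (Circle.exp θ)) = f θ := by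
  have h1 : ∀ θ, f (Complex.arg (Circle.exp θ)) = f θ := by
    intro θ
    have h2 : Circle.exp (Complex.arg (Circle.exp θ)) = Circle.exp θ := Circle.exp_arg _
    obtain ⟨n, hn⟩ := Circle.exp_eq_exp.1 h2
    rw [hn]
    exact hper.int_mul n θ
  refine ⟨?_, h1⟩
  have hq : IsOpenQuotientMap Circle.exp :=
    ⟨fun z => ⟨_, Circle.exp_arg z⟩, Circle.exp.continuous, isLocalHomeomorph_circleExp.isOpenMap⟩
  exact hq.isQuotientMap.continuous_iff.2 (hf.congr fun θ => (h1 θ).symm)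

variable {m : ℕ}

/-- The rotational hypersurface generated by the curve `(A, b)`. -/
def rotationalSet (m : ℕ) (A : ℝ → ℂ) (b : ℝ → ℝ) :
    Set (WithLp 2 (ℂ × EuclideanSpace ℝ (Fin m))) :=
  {p | ∃ (θ : ℝ) (x : EuclideanSpace ℝ (Fin m)), ‖x‖ = 1 ∧ WithLp.toLp 2 (A θ, b θ • x) = p}

/-- The rotational map of a closed curve. -/
noncomputable def rotationalMap (m : ℕ) (A : ℝ → ℂ) (b : ℝ → ℝ)
    (p : Circle × Metric.sphere (0 : EuclideanSpace ℝ (Fin m)) 1) :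
    WithLp 2 (ℂ × EuclideanSpace ℝ (Fin m)) :=
  WithLp.toLp 2 (A (Complex.arg p.1), b (Complex.arg p.1) • (p.2 : EuclideanSpace ℝ (Fin m)))

variable {A : ℝ → ℂ} {a b : ℝ → ℝ}

theorem rotationalMap_exp (hA : Continuous A) (hb : Continuous b)
    (hAp : Function.Periodic A (2 * Real.pi)) (hbp : Function.Periodic b (2 * Real.pi)) (θ : ℝ)
    (x : Metric.sphere (0 : EuclideanSpace ℝ (Fin m)) 1) :
    rotationalMap m A b (Circle.exp θ, x) = WithLp.toLp 2 (A θ, b θ • (x : EuclideanSpace ℝ _)) := by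
  simp only [rotationalMap, (circle_lift hA hAp).2, (circle_lift hb hbp).2]

theorem continuous_rotationalMap (hA : Continuous A) (hb : Continuous b)
    (hAp : Function.Periodic A (2 * Real.pi)) (hbp : Function.Periodic b (2 * Real.pi)) :
    Continuous (rotationalMap m A b) :=
  (WithLp.prod_continuous_toLp 2 _ _).comp
    (((circle_lift hA hAp).1.comp continuous_fst).prodMk
      (((circle_lift hb hbp).1.comp continuous_fst).smul
        (continuous_subtype_val.comp continuous_snd)))

theorem range_rotationalMap (hA : Continuous A) (hb : Continuous b)
    (hAp : Function.Periodic A (2 * Real.pi)) (hbp : Function.Periodic b (2 * Real.pi)) :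
    range (rotationalMap m A b) = rotationalSet m A b := by
  ext p
  constructor
  · rintro ⟨⟨z, x⟩, rfl⟩
    exact ⟨Complex.arg z, x, by simp, rfl⟩
  · rintro ⟨θ, x, hx, rfl⟩
    exact ⟨(Circle.exp θ, ⟨x, by simpa using hx⟩), rotationalMap_exp hA hb hAp hbp _ _⟩

/-- The source is compact, so injectivity is enough. As a > 0, the direction of A determines the
point of the circle; as b > 0, the second component then determines x. -/
theorem isEmbedding_rotationalMap (hA : Continuous A) (hb : Continuous b)
    (hAp : Function.Periodic A (2 * Real.pi)) (hbp : Function.Periodic b (2 * Real.pi))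
    (hAa : ∀ θ, A θ = a θ * Complex.exp (θ * Complex.I)) (ha : ∀ θ, 0 < a θ) (hb0 : ∀ θ, 0 < b θ) :
    IsEmbedding (rotationalMap m A b) := by
  refine ((continuous_rotationalMap hA hb hAp hbp).isClosedEmbedding ?_).isEmbedding
  rintro ⟨z, x⟩ ⟨z', x'⟩ h
  simp only [rotationalMap, WithLp.toLp.injEq, Prod.mk.injEq] at h
  obtain ⟨h1, h2⟩ := h
  have hz : ∀ z : Circle, A (Complex.arg z) = a (Complex.arg z) * (z : ℂ) := fun z => by
    rw [hAa, ← Circle.coe_exp, Circle.exp_arg]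
  rw [hz, hz] at h1
  have h3 : a (Complex.arg z) = a (Complex.arg z') := by
    have h4 := congrArg norm h1
    rw [norm_mul, norm_mul, Circle.norm_coe, Circle.norm_coe, Complex.norm_real, Complex.norm_real,
      Real.norm_of_nonneg (ha _).le, Real.norm_of_nonneg (ha _).le] at h4
    linarith
  have h4 : z = z' := by
    rw [h3] at h1
    have : ((a (Complex.arg z') : ℝ) : ℂ) ≠ 0 := by exact_mod_cast (ha _).ne'
    exact Circle.ext (mul_left_cancel₀ this h1)
  subst h4
  rw [Prod.mk.injEq]
  exact ⟨rfl, Subtype.ext (smul_right_injective _ (hb0 _).ne' h2)⟩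

theorem arg_mul_exp {r τ : ℝ} (hr : 0 < r) (hτ : τ ∈ Ioo (-Real.pi) Real.pi) :
    Complex.arg (r * Complex.exp (τ * Complex.I)) = τ := by
  rw [Complex.exp_mul_I]
  exact Complex.arg_mul_cos_add_sin_mul_I hr ⟨hτ.1, hτ.2.le⟩

/-- The phase of A is the curve parameter itself, so the chart has an explicit inverse Ψ: the
argument of the first component, rotated back by t, is log ‖w‖, and the second component gives w /
‖w‖. It is continuous on the open set O where that argument is away from the cut. -/
theorem isLocalParametrization_rotChart (hA : ContDiff ℝ ∞ A) (hb : ContDiff ℝ ∞ b)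
    (hAp : Function.Periodic A (2 * Real.pi)) (hbp : Function.Periodic b (2 * Real.pi))
    (hAa : ∀ θ, A θ = a θ * Complex.exp (θ * Complex.I)) (ha : ∀ θ, 0 < a θ) (hb0 : ∀ θ, 0 < b θ)
    (hA' : ∀ θ, deriv A θ ≠ 0) (t : ℝ) :
    IsLocalParametrization (rotationalSet m A b)
      {w | w ≠ 0 ∧ Real.log ‖w‖ ∈ Ioo (-Real.pi) Real.pi} (rotChart A b t) := by
  set U : Set (EuclideanSpace ℝ (Fin m)) := {w | w ≠ 0 ∧ Real.log ‖w‖ ∈ Ioo (-Real.pi) Real.pi}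
    with hU
  set E := WithLp 2 (ℂ × EuclideanSpace ℝ (Fin m)) with hE
  set z : E → ℂ := fun p => p.fst * Complex.exp (-(t * Complex.I)) with hz
  set O : Set E := {p | z p ∈ Complex.slitPlane ∧ p.snd ≠ 0} with hO
  set Ψ : E → EuclideanSpace ℝ (Fin m) :=
    fun p => Real.exp (Complex.arg (z p)) • (‖p.snd‖⁻¹ • p.snd) with hΨ
  have hfst : Continuous fun p : E => p.fst :=
    continuous_fst.comp (WithLp.prod_continuous_ofLp 2 _ _)
  have hsnd : Continuous fun p : E => p.snd :=
    continuous_snd.comp (WithLp.prod_continuous_ofLp 2 _ _)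
  have hzc : Continuous z := hfst.mul continuous_const
  have hOo : IsOpen O := (Complex.isOpen_slitPlane.preimage hzc).inter (isOpen_ne.preimage hsnd)
  have hΨc : ContinuousOn Ψ O := fun p hp => by
    refine ContinuousAt.continuousWithinAt ?_
    exact (Real.continuous_exp.continuousAt.comp
      ((Complex.continuousAt_arg hp.1).comp hzc.continuousAt)).smul
      ((hsnd.norm.continuousAt.inv₀ (norm_ne_zero_iff.2 hp.2)).smul hsnd.continuousAt)
  have hzA : ∀ θ (x : EuclideanSpace ℝ (Fin m)), z (WithLp.toLp 2 (A θ, x)) =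
      a θ * Complex.exp ((θ - t : ℝ) * Complex.I) := by
    intro θ x
    simp only [hz, hAa, WithLp.toLp_fst]
    rw [mul_assoc, ← Complex.exp_add]
    congr 2
    push_cast
    ring
  have hleft : ∀ w ∈ U, rotChart A b t w ∈ rotationalSet m A b ∩ O ∧ Ψ (rotChart A b t w) = w := by
    rintro w ⟨hw, hl⟩
    have hn := norm_pos_iff.2 hw
    have hu : ‖‖w‖⁻¹ • w‖ = 1 := by rw [norm_smul, norm_inv, norm_norm, inv_mul_cancel₀ hn.ne']
    have harg : Complex.arg (z (rotChart A b t w)) = Real.log ‖w‖ := by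
      rw [rotChart_apply hw, hzA, add_sub_cancel_left, arg_mul_exp (ha _) hl]
    refine ⟨⟨⟨_, _, hu, (rotChart_apply hw).symm⟩, ?_, ?_⟩, ?_⟩
    · rw [Complex.mem_slitPlane_iff_arg, harg]
      refine ⟨hl.2.ne, ?_⟩
      rw [rotChart_apply hw, hzA]
      exact mul_ne_zero (by exact_mod_cast (ha _).ne') (Complex.exp_ne_zero _)
    · rw [rotChart_apply hw, WithLp.toLp_snd]
      exact smul_ne_zero (hb0 _).ne' (norm_ne_zero_iff.1 (by rw [hu]; exact one_ne_zero))
    · simp only [hΨ]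
      rw [harg, rotChart_apply hw, WithLp.toLp_snd, norm_smul, hu, Real.exp_log hn,
        Real.norm_of_nonneg (hb0 _).le, mul_one, inv_smul_smul₀ (hb0 _).ne', smul_inv_smul₀ hn.ne']
  have hright : ∀ p ∈ rotationalSet m A b ∩ O, rotChart A b t (Ψ p) = p := by
    rintro _ ⟨⟨θ, x, hx, rfl⟩, hp, -⟩
    set τ := Complex.arg (z (WithLp.toLp 2 (A θ, b θ • x))) with hτ
    have hx0 : x ≠ 0 := by rintro rfl; simp at hx
    have hΨx : Ψ (WithLp.toLp 2 (A θ, b θ • x)) = Real.exp τ • x := by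
      simp only [hΨ, ← hτ]
      rw [WithLp.toLp_snd, norm_smul, hx, mul_one, Real.norm_of_nonneg (hb0 _).le,
        inv_smul_smul₀ (hb0 _).ne']
    have hnorm : ‖Real.exp τ • x‖ = Real.exp τ := by
      rw [norm_smul, hx, mul_one, Real.norm_of_nonneg (Real.exp_pos _).le]
    obtain ⟨k, hk⟩ : ∃ k : ℤ, t + τ = θ + k * (2 * Real.pi) := by
      have h1 := Complex.norm_mul_exp_arg_mul_I (z (WithLp.toLp 2 (A θ, b θ • x)))
      rw [← hτ, hzA, norm_mul, Complex.norm_exp_ofReal_mul_I, mul_one, Complex.norm_real,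
        Real.norm_of_nonneg (ha _).le] at h1
      have h2 := mul_left_cancel₀ (by exact_mod_cast (ha θ).ne') h1
      obtain ⟨k, hk⟩ := Complex.exp_eq_exp_iff_exists_int.1 h2
      refine ⟨k, ?_⟩
      have h3 := congrArg Complex.im hk
      simp at h3
      linarith
    rw [hΨx, rotChart_apply (smul_ne_zero (Real.exp_pos _).ne' hx0), hnorm, Real.log_exp,
      inv_smul_smul₀ (Real.exp_pos _).ne', hk, hAp.int_mul, hbp.int_mul]
  refine ⟨?_, ?_, ?_, ?_, ?_⟩
  · have h1 : ContinuousOn (fun w : EuclideanSpace ℝ (Fin m) => Real.log ‖w‖) {w | w ≠ 0} :=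
      continuous_norm.continuousOn.log fun w hw => norm_ne_zero_iff.2 hw
    exact h1.isOpen_inter_preimage isOpen_ne isOpen_Ioo
  · exact fun w hw => (contDiffAt_rotChart hA hb hw.1).contDiffWithinAt
  · intro w hw w' hw' h
    rw [← (hleft w hw).2, ← (hleft w' hw').2, h]
  · intro w hw
    refine (injective_iff_map_eq_zero _).2 fun v hv => ?_
    rw [fderiv_rotChart (hA.differentiable (by simp)) (hb.differentiable (by simp)) hw.1] at hv
    have h1 := congrArg (fun p : E => p.fst) hv
    have h2 := congrArg (fun p : E => p.snd) hv
    simp only [WithLp.toLp_fst, WithLp.toLp_snd, WithLp.zero_fst, WithLp.zero_snd] at h1 h2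
    rw [smul_eq_zero, or_iff_left (hA' _)] at h1
    rw [h1, zero_mul, zero_smul, add_zero, smul_eq_zero] at h2
    exact h2.resolve_left (mul_pos (hb0 _) (inv_pos.2 (norm_pos_iff.2 hw.1))).ne'
  · intro V hVU hV
    refine ⟨O ∩ Ψ ⁻¹' V, hΨc.isOpen_inter_preimage hOo hV, ?_⟩
    ext p
    constructor
    · rintro ⟨w, hw, rfl⟩
      obtain ⟨⟨h1, h2⟩, h3⟩ := hleft w (hVU hw)
      exact ⟨h1, h2, by rwa [mem_preimage, h3]⟩
    · rintro ⟨h1, h2, h3⟩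
      exact ⟨Ψ p, h3, hright p ⟨h1, h2⟩⟩

theorem isEmbeddedCMC_rotationalSet {B : ℝ → ℂ} {c : ℝ → ℝ} {h : ℝ}
    (hA : ContDiff ℝ ∞ A) (hb : ContDiff ℝ ∞ b) (hB : ContDiff ℝ ∞ B) (hc : ContDiff ℝ ∞ c)
    (hAp : Function.Periodic A (2 * Real.pi)) (hbp : Function.Periodic b (2 * Real.pi))
    (hBp : Function.Periodic B (2 * Real.pi)) (hcp : Function.Periodic c (2 * Real.pi))
    (hAa : ∀ θ, A θ = a θ * Complex.exp (θ * Complex.I)) (ha : ∀ θ, 0 < a θ) (hb0 : ∀ θ, 0 < b θ)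
    (hA' : ∀ θ, deriv A θ ≠ 0) (hAb : ∀ θ, ‖A θ‖ ^ 2 + b θ ^ 2 = 1)
    (hBc : ∀ θ, ‖B θ‖ ^ 2 + c θ ^ 2 = 1) (hBA : ∀ θ, inner ℝ (B θ) (A θ) + c θ * b θ = 0)
    (horth : ∀ θ, inner ℝ (deriv A θ) (B θ) + deriv b θ * c θ = 0)
    (hcurv : ∀ θ, -(inner ℝ (deriv A θ) (deriv B θ) + deriv b θ * deriv c θ) /
        (‖deriv A θ‖ ^ 2 + deriv b θ ^ 2) + ((m : ℝ) - 1) * (-(c θ) / b θ) = h) :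
    IsEmbeddedCMC m h (rotationalSet m A b) := by
  have hemb := isEmbedding_rotationalMap (m := m) hA.continuous hb.continuous hAp hbp hAa ha hb0
  have hrange := range_rotationalMap (m := m) hA.continuous hb.continuous hAp hbp
  have hNc := continuous_rotationalMap (m := m) hB.continuous hc.continuous hBp hcp
  have hnsq : ∀ (z : ℂ) (s : ℝ) (x : EuclideanSpace ℝ (Fin m)), ‖x‖ = 1 → ‖z‖ ^ 2 + s ^ 2 = 1 →
      ‖(WithLp.toLp 2 (z, s • x) : WithLp 2 (ℂ × EuclideanSpace ℝ (Fin m)))‖ = 1 := by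
    intro z s x hx hzs
    have : ‖(WithLp.toLp 2 (z, s • x) : WithLp 2 (ℂ × EuclideanSpace ℝ (Fin m)))‖ ^ 2 = 1 := by
      rw [← real_inner_self_eq_norm_sq, inner_toLp, real_inner_self_eq_norm_sq,
        real_inner_self_eq_norm_sq, norm_smul, hx, mul_one, Real.norm_eq_abs, sq_abs, hzs]
    exact (pow_eq_one_iff_of_nonneg (norm_nonneg _) two_ne_zero).1 this
  -- The normal field is transported to the image through the embedding, which also transports its
  -- continuity.
  set ν := Function.extend (rotationalMap m A b) (rotationalMap m B c) 0 with hν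
  have hνι : ∀ p, ν (rotationalMap m A b p) = rotationalMap m B c p := fun p =>
    hemb.injective.extend_apply _ _ p
  refine ⟨?_, ν, ?_, ?_⟩
  · rintro _ ⟨θ, x, hx, rfl⟩
    rw [mem_sphere_zero_iff_norm]
    exact hnsq _ _ x hx (hAb θ)
  · rw [← hrange]
    rintro _ ⟨p, rfl⟩
    rw [ContinuousWithinAt, ← hemb.map_nhds_eq, tendsto_map'_iff, hνι]
    rw [show ν ∘ rotationalMap m A b = rotationalMap m B c from funext hνι]
    exact hNc.continuousAt
  · rintro _ ⟨θ, x, hx, rfl⟩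
    have hx0 : x ≠ 0 := by rintro rfl; simp at hx
    have hνp : ν (WithLp.toLp 2 (A θ, b θ • x)) = WithLp.toLp 2 (B θ, c θ • x) := by
      have h1 := rotationalMap_exp hA.continuous hb.continuous hAp hbp θ ⟨x, by simpa using hx⟩
      have h2 := rotationalMap_exp hB.continuous hc.continuous hBp hcp θ
        (⟨x, by simpa using hx⟩ : Metric.sphere (0 : EuclideanSpace ℝ (Fin m)) 1)
      rw [← h1, hνι, h2]
    have happ : ∀ (P : ℝ → ℂ) (q : ℝ → ℝ), rotChart P q θ x = WithLp.toLp 2 (P θ, q θ • x) := by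
      intro P q
      rw [rotChart_apply hx0, hx]
      simp
    rw [hνp]
    -- The chart is centred at the phase θ of the given point, which then has the coordinate x
    -- itself, with log ‖x‖ = 0.
    refine ⟨hnsq _ _ x hx (hBc θ), ?_, _, rotChart A b θ,
      isLocalParametrization_rotChart hA hb hAp hbp hAa ha hb0 hA' θ, x, ⟨hx0, ?_⟩, happ A b, ?_, ?_⟩
    · rw [inner_toLp, inner_smul_left, inner_smul_right, real_inner_self_eq_norm_sq, hx, ← hBA θ]
      simp
    · rw [hx, Real.log_one]
      exact ⟨by linarith [Real.pi_pos], Real.pi_pos⟩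
    · intro w
      rw [← happ B c]
      exact inner_fderiv_rotChart_normal (hA.differentiable (by simp)) (hb.differentiable (by simp))
        horth hx0 w
    · rw [← happ B c, meanCurvature_rotChart hA hb hB hc horth hx (hb0 θ).ne' ?_, hcurv θ]
      have : 0 < ‖deriv A θ‖ := norm_pos_iff.2 (hA' θ)
      positivity

end Rotational

end Delaunay

/-! ### Calculus in the rotating frame -/

namespace Delaunay

open Filter Topology

section RotatingFrame

/-- The curve with coordinates `(u, v)` in the rotating frame. -/
noncomputable def rotating (u v : ℝ → ℝ) (θ : ℝ) : ℂ :=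
  ((u θ : ℂ) + (v θ : ℂ) * Complex.I) * Complex.exp (θ * Complex.I)

theorem contDiff_rotating {u v : ℝ → ℝ} (hu : ContDiff ℝ ∞ u) (hv : ContDiff ℝ ∞ v) :
    ContDiff ℝ ∞ (rotating u v) := by
  have h : ∀ {f : ℝ → ℝ}, ContDiff ℝ ∞ f → ContDiff ℝ ∞ fun θ => (f θ : ℂ) := fun hf =>
    Complex.ofRealCLM.contDiff.comp hf
  exact ((h hu).add ((h hv).mul contDiff_const)).mul
    (Complex.contDiff_exp.comp ((h contDiff_id).mul contDiff_const))

theorem deriv_rotating {u v : ℝ → ℝ} {u' v' θ : ℝ} (hu : HasDerivAt u u' θ)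
    (hv : HasDerivAt v v' θ) : deriv (rotating u v) θ =
      (((u' - v θ : ℝ) : ℂ) + ((v' + u θ : ℝ) : ℂ) * Complex.I) *
        Complex.exp (θ * Complex.I) := by
  have h1 : HasDerivAt (fun θ : ℝ => Complex.exp (θ * Complex.I))
      (Complex.exp (θ * Complex.I) * (1 * Complex.I)) θ :=
    ((hasDerivAt_id θ).ofReal_comp.mul_const Complex.I).cexp
  have h2 := (hu.ofReal_comp.add (hv.ofReal_comp.mul_const Complex.I)).mul h1
  refine h2.deriv.trans ?_
  simp only [Pi.add_apply]
  push_cast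
  linear_combination (-(v θ : ℂ) * Complex.exp (θ * Complex.I)) * Complex.I_sq.symm

theorem inner_rotating (x y x' y' θ : ℝ) :
    inner ℝ (((x : ℂ) + (y : ℂ) * Complex.I) * Complex.exp (θ * Complex.I))
      (((x' : ℂ) + (y' : ℂ) * Complex.I) * Complex.exp (θ * Complex.I)) = x * x' + y * y' := by
  rw [Complex.inner]
  simp [Complex.exp_ofReal_mul_I_re, Complex.exp_ofReal_mul_I_im]
  linear_combination (x * x' + y * y') * Real.sin_sq_add_cos_sq θ

theorem norm_sq_rotating (x y θ : ℝ) :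
    ‖((x : ℂ) + (y : ℂ) * Complex.I) * Complex.exp (θ * Complex.I)‖ ^ 2 = x ^ 2 + y ^ 2 := by
  rw [← real_inner_self_eq_norm_sq, inner_rotating]; ring

theorem periodic_rotating {u v : ℝ → ℝ} (hu : Function.Periodic u (2 * Real.pi))
    (hv : Function.Periodic v (2 * Real.pi)) :
    Function.Periodic (rotating u v) (2 * Real.pi) := by
  intro θ
  rw [rotating, rotating, hu, hv]
  push_cast
  rw [add_mul (θ : ℂ), Complex.exp_add, Complex.exp_two_pi_mul_I, mul_one]

end RotatingFrame

/-! ### The profile curve and its mean curvature equation -/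

section Profile

variable {n : ℕ} {h C : ℝ} {σ : ℝ → ℝ}

/-- R' = hL, and the logarithmic derivative of L is (n-2) cot - tan. For ρ = R/L this is the mean
curvature equation, of which R = ρL is the first integral with constant C. -/
theorem hasDerivAt_R_div_L (hn : 3 ≤ n) {s : ℝ} (hs : s ∈ Ioo 0 (Real.pi / 2)) :
    HasDerivAt (fun s => R n h C s / L n s) (h + R n h C s / L n s * Real.tan s -
      ((n : ℝ) - 2) * (R n h C s / L n s * Real.cos s / Real.sin s)) s := by
  have h1 := sin_pos_of_mem hs
  have h2 := cos_pos_of_mem hs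
  have h3 := L_pos (n := n) hs
  have h4 := sub_one_pos hn
  have hR : HasDerivAt (R n h C) (h * L n s) s := by
    obtain ⟨k, rfl⟩ := Nat.exists_eq_add_of_le' hn
    have h5 := (((Real.hasDerivAt_sin s).fun_pow (k + 3 - 1)).const_mul
      (h / (((k + 3 : ℕ) : ℝ) - 1))).const_add C
    refine h5.congr_deriv ?_
    unfold L
    simp only [show k + 3 - 2 = k + 1 from rfl,
      show k + 3 - 1 = k + 2 from rfl]
    push_cast at h4 ⊢
    rw [show (k : ℝ) + 3 - 1 = k + 2 by ring] at h4 ⊢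
    field_simp
  have hL : HasDerivAt (L n) (L n s * (((n : ℝ) - 2) * (Real.cos s / Real.sin s) -
      Real.tan s)) s := by
    obtain ⟨k, rfl⟩ := Nat.exists_eq_add_of_le' hn
    have h5 := (Real.hasDerivAt_cos s).fun_mul ((Real.hasDerivAt_sin s).fun_pow (k + 3 - 2))
    refine h5.congr_deriv ?_
    unfold L
    rw [Real.tan_eq_sin_div_cos]
    simp only [show k + 3 - 2 = k + 1 from rfl]
    push_cast
    field_simp
    ring
  refine (hR.fun_div hL h3.ne').congr_deriv ?_
  field_simp
  ring

/-- Beyond the oscillation this records the first integral in squared form, which makes sense at the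
turning points too. It comes from σ'² = (L - R) / weight² = cos² (L² - R²) / R². -/
theorem exists_profile (hn : 3 ≤ n) (hh : 0 < h) (hC : C ∈ Ioo 0 (contactConstant n h)) :
    ∃ σ : ℝ → ℝ, IsOscillatingProfile n h C σ ∧ (∀ θ, σ θ ∈ Ioo 0 (Real.pi / 2)) ∧
      (∀ θ, (R n h C (σ θ) / L n (σ θ)) ^ 2 * (Real.cos (σ θ) ^ 2 + deriv σ θ ^ 2) =
        Real.cos (σ θ) ^ 2) ∧ {θ | deriv σ θ = 0}.Countable := by
  obtain ⟨y, S, hy⟩ := exists_isGapCoordinate hn hh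
  have hε : 0 < √(contactConstant n h - C) := Real.sqrt_pos.2 (by linarith [hC.2])
  have hJ := J_eq_sublevel hn hh hy hC
  have hm : MeasurableSet (J n h C) := by
    obtain ⟨r₁, r₂, -, -, -, hJ, -⟩ := J_eq_Ioo hn hh hy hC
    rw [hJ]; exact measurableSet_Ioo
  have hpd : ∀ s ∈ Ioo 0 (Real.pi / 2), phaseDeriv n h C s =
      weight n h C s / √(√(contactConstant n h - C) ^ 2 - y s ^ 2) := fun s hs =>
    phaseDeriv_eq_coordinate hn hh hy hC hs
  have hW : W n h C =
      2 * ∫ s in J n h C, weight n h C s / √(√(contactConstant n h - C) ^ 2 - y s ^ 2) := by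
    rw [W, setIntegral_congr_fun hm fun s hs => hpd s hs.1]
  obtain ⟨σ, h1, h2, h3, h4, h5, h6, h7, h8, h9, h10, h11⟩ := exists_oscillation hy.contDiffOn
    hy.deriv_pos hy.leftInv hε (gapCoordinate_subset hn hh hy hC.1) (contDiffOn_weight hn hh hC.1)
    (fun s hs => weight_pos hn hh hC.1 hs) hJ hW
  refine ⟨σ, ⟨h1, h2, h3, h4, h5, fun θ hθ => ?_, h7, h8⟩, h9, fun θ => ?_, h11⟩
  · rw [hpd _ (h9 θ)]; exact h6 θ hθ
  · have hRp := R_pos hn hh hC.1 (h9 θ)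
    have hLp := L_pos (n := n) (h9 θ)
    have hcos := cos_pos_of_mem (h9 θ)
    have hg : √(contactConstant n h - C) ^ 2 - y (σ θ) ^ 2 = L n (σ θ) - R n h C (σ θ) := by
      rw [L_sub_R, hy.gap_eq _ (h9 θ), Real.sq_sqrt (by linarith [hC.2])]; ring
    have hw : weight n h C (σ θ) ^ 2 =
        R n h C (σ θ) ^ 2 / (Real.cos (σ θ) ^ 2 * (L n (σ θ) + R n h C (σ θ))) := by
      rw [weight, div_pow, mul_pow, Real.sq_sqrt (by positivity)]
    rw [h10, hg, hw]
    field_simp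
    ring

theorem contDiff_R_div_L_comp (hσ : ContDiff ℝ ∞ σ) (hI : ∀ θ, σ θ ∈ Ioo 0 (Real.pi / 2)) :
    ContDiff ℝ ∞ fun θ => R n h C (σ θ) / L n (σ θ) :=
  (contDiff_R.comp hσ).div (contDiff_L.comp hσ) fun θ => (L_pos (hI θ)).ne'

/-- The tangential component of the normal of the profile curve, up to sign, solves a first order
equation, also at the turning points. -/
theorem hasDerivAt_tilt (hn : 3 ≤ n) (hh : 0 < h) (hC : 0 < C) (hσ : ContDiff ℝ ∞ σ)
    (hI : ∀ θ, σ θ ∈ Ioo 0 (Real.pi / 2))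
    (hsq : ∀ θ, (R n h C (σ θ) / L n (σ θ)) ^ 2 * (Real.cos (σ θ) ^ 2 + deriv σ θ ^ 2) =
        Real.cos (σ θ) ^ 2) (hcount : {θ | deriv σ θ = 0}.Countable) (θ : ℝ) :
    HasDerivAt (fun θ => R n h C (σ θ) / L n (σ θ) * deriv σ θ / Real.cos (σ θ))
      (-(h + R n h C (σ θ) / L n (σ θ) * Real.tan (σ θ) -
      ((n : ℝ) - 2) * (R n h C (σ θ) / L n (σ θ) * Real.cos (σ θ) / Real.sin (σ θ))) *
        Real.cos (σ θ)) θ := by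
  set ρ : ℝ → ℝ := fun θ => R n h C (σ θ) / L n (σ θ) with hρ
  set D : ℝ → ℝ := fun θ => h + ρ θ * Real.tan (σ θ) -
      ((n : ℝ) - 2) * (ρ θ * Real.cos (σ θ) / Real.sin (σ θ)) with hD
  set p : ℝ → ℝ := fun θ => ρ θ * deriv σ θ / Real.cos (σ θ) with hp
  have hρs : ContDiff ℝ ∞ ρ := contDiff_R_div_L_comp hσ hI
  have hcos : ∀ θ, 0 < Real.cos (σ θ) := fun θ => cos_pos_of_mem (hI θ)
  have hsin : ∀ θ, 0 < Real.sin (σ θ) := fun θ => sin_pos_of_mem (hI θ)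
  have hρpos : ∀ θ, 0 < ρ θ := fun θ => div_pos (R_pos hn hh hC (hI θ)) (L_pos (hI θ))
  have hps : ContDiff ℝ ∞ p :=
    (hρs.mul (contDiff_infty_iff_deriv.1 hσ).2).div (Real.contDiff_cos.comp hσ) fun θ => (hcos θ).ne'
  have hσd : ∀ θ, HasDerivAt σ (deriv σ θ) θ := fun θ =>
    (hσ.differentiable (by simp) θ).hasDerivAt
  have hpd : ∀ θ, HasDerivAt p (deriv p θ) θ := fun θ => (hps.differentiable (by simp) θ).hasDerivAt
  have hρd : ∀ θ, HasDerivAt ρ (D θ * deriv σ θ) θ := fun θ =>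
    (hasDerivAt_R_div_L hn (hI θ)).comp θ (hσd θ)
  have hone : ∀ θ, p θ ^ 2 + ρ θ ^ 2 = 1 := by
    intro θ
    have h1 := hsq θ
    have h2 := (hcos θ).ne'
    change ρ θ ^ 2 * _ = _ at h1
    simp only [hp]
    field_simp
    linarith
  -- This is the derivative of p² + ρ² = 1, with ρ' = Dσ' and ρσ' = p cos σ.
  have hmul : ∀ θ, p θ * (deriv p θ + D θ * Real.cos (σ θ)) = 0 := by
    intro θ
    have h1 := ((hpd θ).fun_pow 2).add ((hρd θ).fun_pow 2)
    have h2 : HasDerivAt ((fun θ => p θ ^ 2) + fun θ => ρ θ ^ 2) 0 θ :=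
      (hasDerivAt_const θ (1 : ℝ)).congr_of_eventuallyEq (Eventually.of_forall hone)
    have h3 := h1.unique h2
    have h4 : ρ θ * deriv σ θ = p θ * Real.cos (σ θ) := by
      simp only [hp]; have := (hcos θ).ne'; field_simp
    norm_num at h3
    linear_combination h3 / 2 - D θ * h4
  have hcont : Continuous fun θ => deriv p θ + D θ * Real.cos (σ θ) := by
    have h1 : Continuous (deriv p) := (contDiff_infty_iff_deriv.1 hps).2.continuous
    have h2 : Continuous fun θ => Real.cos (σ θ) := Real.continuous_cos.comp hσ.continuous
    have h3 : Continuous fun θ => Real.sin (σ θ) := Real.continuous_sin.comp hσ.continuous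
    have h4 : Continuous fun θ => Real.tan (σ θ) := by
      simp only [Real.tan_eq_sin_div_cos]
      exact h3.div h2 fun θ => (hcos θ).ne'
    exact h1.add (((continuous_const.add (hρs.continuous.mul h4)).sub
      (continuous_const.mul ((hρs.continuous.mul h2).div h3 fun θ => (hsin θ).ne'))).mul h2)
  -- The factor p can be cancelled off the countable set of turning points, whose complement is
  -- dense; continuity does the rest.
  have hzero := Continuous.ext_on (hcount.dense_compl ℝ) hcont continuous_const (g := fun _ => 0)
    fun θ hθ => by
      have h1 : p θ ≠ 0 := div_ne_zero (mul_ne_zero (hρpos θ).ne' hθ) (hcos θ).ne'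
      exact (mul_eq_zero.1 (hmul θ)).resolve_left h1
  have h5 : deriv p θ = -D θ * Real.cos (σ θ) := by
    have := congrFun hzero θ
    linarith
  rw [← h5]
  exact hpd θ

theorem phaseCurve_eq (σ : ℝ → ℝ) (θ : ℝ) : phaseCurve σ θ =
    (rotating (fun θ => Real.cos (σ θ)) 0 θ, Real.sin (σ θ)) := by
  simp [phaseCurve, rotating]

theorem hypersurface_eq (σ : ℝ → ℝ) : hypersurface n σ = rotationalSet (n - 1)
    (rotating (fun θ => Real.cos (σ θ)) 0) (fun θ => Real.sin (σ θ)) := by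
  ext p
  simp only [hypersurface, spiralProduct, phaseCurve_eq]
  rfl

theorem isEmbeddedCMC_hypersurface (hn : 3 ≤ n) (hh : 0 < h) (hC : 0 < C) (hσ : ContDiff ℝ ∞ σ)
    (hI : ∀ θ, σ θ ∈ Ioo 0 (Real.pi / 2))
    (hsq : ∀ θ, (R n h C (σ θ) / L n (σ θ)) ^ 2 * (Real.cos (σ θ) ^ 2 + deriv σ θ ^ 2) =
        Real.cos (σ θ) ^ 2) (hcount : {θ | deriv σ θ = 0}.Countable)
    (hper : Function.Periodic σ (2 * Real.pi)) :
    IsEmbeddedCMC (n - 1) h (hypersurface n σ) := by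
  have hcos : ∀ θ, 0 < Real.cos (σ θ) := fun θ => cos_pos_of_mem (hI θ)
  have hsin : ∀ θ, 0 < Real.sin (σ θ) := fun θ => sin_pos_of_mem (hI θ)
  set ρ : ℝ → ℝ := fun θ => R n h C (σ θ) / L n (σ θ) with hρ
  set D : ℝ → ℝ := fun θ => h + ρ θ * Real.tan (σ θ) -
      ((n : ℝ) - 2) * (ρ θ * Real.cos (σ θ) / Real.sin (σ θ)) with hD
  set p : ℝ → ℝ := fun θ => ρ θ * deriv σ θ / Real.cos (σ θ) with hp
  have hρs : ContDiff ℝ ∞ ρ := contDiff_R_div_L_comp hσ hI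
  have hcs : ContDiff ℝ ∞ fun θ => Real.cos (σ θ) := Real.contDiff_cos.comp hσ
  have hss : ContDiff ℝ ∞ fun θ => Real.sin (σ θ) := Real.contDiff_sin.comp hσ
  have hps : ContDiff ℝ ∞ p :=
    (hρs.mul (contDiff_infty_iff_deriv.1 hσ).2).div hcs fun θ => (hcos θ).ne'
  have hσd : ∀ θ, HasDerivAt σ (deriv σ θ) θ := fun θ =>
    (hσ.differentiable (by simp) θ).hasDerivAt
  have hρd : ∀ θ, HasDerivAt ρ (D θ * deriv σ θ) θ := fun θ =>
    (hasDerivAt_R_div_L hn (hI θ)).comp θ (hσd θ)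
  have hpd : ∀ θ, HasDerivAt p (-D θ * Real.cos (σ θ)) θ :=
    hasDerivAt_tilt hn hh hC hσ hI hsq hcount
  have hdper : Function.Periodic (deriv σ) (2 * Real.pi) := fun θ => by
    rw [← deriv_comp_add_const]
    exact congrArg (fun f => deriv f θ) (funext hper)
  have hρper : Function.Periodic ρ (2 * Real.pi) := fun θ => by simp only [hρ, hper θ]
  have hcper : Function.Periodic (fun θ => Real.cos (σ θ)) (2 * Real.pi) := fun θ => by
    simp only [hper θ]
  have hsper : Function.Periodic (fun θ => Real.sin (σ θ)) (2 * Real.pi) := fun θ => by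
    simp only [hper θ]
  have hone : ∀ θ, p θ ^ 2 + ρ θ ^ 2 = 1 := by
    intro θ
    have h1 := hsq θ
    have h2 := (hcos θ).ne'
    change ρ θ ^ 2 * _ = _ at h1
    simp only [hp]
    field_simp
    linarith
  have hrel : ∀ θ, ρ θ * deriv σ θ = p θ * Real.cos (σ θ) := fun θ => by
    simp only [hp]; have := (hcos θ).ne'; field_simp
  have hcd : ∀ θ, HasDerivAt (fun θ => Real.cos (σ θ)) (-Real.sin (σ θ) * deriv σ θ) θ :=
    fun θ => (hσd θ).cos
  have hsd : ∀ θ, HasDerivAt (fun θ => Real.sin (σ θ)) (Real.cos (σ θ) * deriv σ θ) θ :=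
    fun θ => (hσd θ).sin
  have hbs : ContDiff ℝ ∞ fun θ => ρ θ * Real.sin (σ θ) := hρs.mul hss
  have hbd := fun θ => (hρd θ).fun_mul (hsd θ)
  have hc0d : ∀ θ, HasDerivAt (fun θ => -(ρ θ * Real.cos (σ θ)))
      (-(D θ * deriv σ θ * Real.cos (σ θ) + ρ θ * (-Real.sin (σ θ) * deriv σ θ))) θ :=
    fun θ => ((hρd θ).fun_mul (hcd θ)).fun_neg
  have hdA := fun θ => deriv_rotating (hcd θ) (hasDerivAt_const θ (0 : ℝ))
  have hdB := fun θ => deriv_rotating (hbd θ) (hpd θ)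
  have htrig := fun θ => Real.sin_sq_add_cos_sq (σ θ)
  rw [hypersurface_eq]
  have hzero : (0 : ℝ → ℝ) = fun _ => 0 := rfl
  rw [hzero]
  -- In the frame of the meridian direction (-sin σ e^{iθ}, cos σ) and the parallel direction i
  -- e^{iθ}, the tangent has components (σ', cos σ), and the normal (B, c) is (-ρ, p).
  refine isEmbeddedCMC_rotationalSet (a := fun θ => Real.cos (σ θ))
    (B := rotating (fun θ => ρ θ * Real.sin (σ θ)) p) (c := fun θ => -(ρ θ * Real.cos (σ θ)))
    (contDiff_rotating hcs contDiff_const) hss (contDiff_rotating hbs hps) (hρs.mul hcs).neg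
    (periodic_rotating hcper fun _ => rfl) hsper
    (periodic_rotating (fun θ => by simp only [hρper θ, hper θ])
      (fun θ => by simp only [hp, hρper θ, hper θ, hdper θ]))
    (fun θ => by simp only [hρper θ, hper θ]) (fun θ => by simp [rotating]) hcos hsin ?_ ?_ ?_ ?_ ?_ ?_
  · intro θ h0
    rw [hdA θ, ← norm_eq_zero, ← sq_eq_zero_iff, norm_sq_rotating] at h0
    have := hcos θ
    nlinarith [sq_nonneg (-Real.sin (σ θ) * deriv σ θ - 0)]
  · intro θ
    rw [rotating, norm_sq_rotating]
    linarith [htrig θ]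
  · intro θ
    rw [rotating, norm_sq_rotating]
    linear_combination hone θ + ρ θ ^ 2 * htrig θ
  · intro θ
    rw [rotating, rotating, inner_rotating]
    ring
  · intro θ
    rw [hdA θ, (hsd θ).deriv, rotating, inner_rotating]
    linear_combination -(ρ θ * deriv σ θ) * htrig θ - hrel θ
  · intro θ
    rw [hdA θ, hdB θ, (hsd θ).deriv, (hc0d θ).deriv, inner_rotating, norm_sq_rotating]
    have hc' := hcos θ
    have hs' := hsin θ
    have hα : (-Real.sin (σ θ) * deriv σ θ - 0) ^ 2 + (0 + Real.cos (σ θ)) ^ 2 +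
        (Real.cos (σ θ) * deriv σ θ) ^ 2 = deriv σ θ ^ 2 + Real.cos (σ θ) ^ 2 := by
      linear_combination deriv σ θ ^ 2 * htrig θ
    have hα0 : deriv σ θ ^ 2 + Real.cos (σ θ) ^ 2 ≠ 0 := by positivity
    have hpp : p θ = ρ θ * deriv σ θ / Real.cos (σ θ) := rfl
    -- The profile direction thus has principal curvature D - ρ tan σ, and the n - 2 rotational
    -- directions have ρ cot σ. By the definition of D they sum to h.
    have hX : (-Real.sin (σ θ) * deriv σ θ - 0) * (D θ * deriv σ θ * Real.sin (σ θ) +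
          ρ θ * (Real.cos (σ θ) * deriv σ θ) - p θ) +
        (0 + Real.cos (σ θ)) * (-D θ * Real.cos (σ θ) + ρ θ * Real.sin (σ θ)) +
        Real.cos (σ θ) * deriv σ θ * -(D θ * deriv σ θ * Real.cos (σ θ) +
          ρ θ * (-Real.sin (σ θ) * deriv σ θ)) =
        (deriv σ θ ^ 2 + Real.cos (σ θ) ^ 2) * (-D θ + ρ θ * Real.tan (σ θ)) := by
      rw [hpp, Real.tan_eq_sin_div_cos]
      field_simp
      linear_combination (-D θ * deriv σ θ ^ 2 * Real.cos (σ θ)) * htrig θ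
    rw [hα, hX, neg_div, mul_div_cancel_left₀ _ hα0, Nat.cast_sub (by omega : 1 ≤ n)]
    simp only [hD]
    push_cast
    ring

end Profile

end Delaunay

/-! ### The theorem -/

theorem mainTheorem6 (n : ℕ) (hn3 : 3 ≤ n) (hn9 : n ≤ 9) :
    {k : ℤ | 2 < k ∧ (Delaunay.Z n k).Nonempty}.Infinite ∧
    ∀ k : ℤ, 2 < k → ∀ h ∈ Delaunay.Z n k,
      ∃ C ∈ Ioo 0 (Delaunay.contactConstant n h),
        IntegrableOn (Delaunay.phaseDeriv n h C) (Delaunay.J n h C) ∧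
        Delaunay.W n h C = 2 * Real.pi / k ∧
        ∃ σ : ℝ → ℝ, Delaunay.IsOscillatingProfile n h C σ ∧
          (∃ ι : Circle × Metric.sphere (0 : EuclideanSpace ℝ (Fin (n - 1))) 1 →
              Delaunay.Ambient n,
            Topology.IsEmbedding ι ∧ range ι = Delaunay.hypersurface n σ ∧
            ∀ θ x, ι (Circle.exp θ, x) =
              Delaunay.spiralProduct (Delaunay.phaseCurve σ) θ (x : EuclideanSpace ℝ _)) ∧
          IsEmbeddedCMC (n - 1) h (Delaunay.hypersurface n σ) := by
  refine ⟨Delaunay.infinite_nonempty_Z hn3 hn9, fun k hk h hZ => ?_⟩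
  have hh := Delaunay.pos_of_mem_Z hn3 hk hZ
  obtain ⟨y, S, hy⟩ := Delaunay.exists_isGapCoordinate hn3 hh
  obtain ⟨C, hC, hCw⟩ := Delaunay.exists_width_eq hn3 hk hZ hy hh
  obtain ⟨hint, heq⟩ := Delaunay.integral_phaseDeriv hn3 hh hy hC
  have hW : Delaunay.W n h C = 2 * Real.pi / k := by
    rw [Delaunay.W, heq, hCw, mul_div_assoc]
  obtain ⟨σ, hσ, hI, hsq, hcount⟩ := Delaunay.exists_profile hn3 hh hC
  -- The k periods of width 2π/k make one full turn.
  have hper : Function.Periodic σ (2 * Real.pi) := by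
    have h1 := hσ.periodic.int_mul k
    have hk0 : (k : ℝ) ≠ 0 := by exact_mod_cast (by omega : k ≠ 0)
    rwa [hW, mul_div_cancel₀ _ hk0] at h1
  have hcs : ContDiff ℝ ∞ fun θ => Real.cos (σ θ) := Real.contDiff_cos.comp hσ.contDiff
  have hA : Continuous (Delaunay.rotating (fun θ => Real.cos (σ θ)) 0) :=
    (Delaunay.contDiff_rotating hcs contDiff_const).continuous
  have hb : Continuous fun θ => Real.sin (σ θ) := Real.continuous_sin.comp hσ.contDiff.continuous
  have hAp : Function.Periodic (Delaunay.rotating (fun θ => Real.cos (σ θ)) 0) (2 * Real.pi) :=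
    Delaunay.periodic_rotating (fun θ => by simp only [hper θ]) fun _ => rfl
  have hbp : Function.Periodic (fun θ => Real.sin (σ θ)) (2 * Real.pi) := fun θ => by
    simp only [hper θ]
  refine ⟨C, hC, hint, hW, σ, hσ, ⟨Delaunay.rotationalMap (n - 1) _ _,
    Delaunay.isEmbedding_rotationalMap hA hb hAp hbp (fun θ => by simp [Delaunay.rotating])
      (fun θ => Delaunay.cos_pos_of_mem (hI θ)) (fun θ => Delaunay.sin_pos_of_mem (hI θ)), ?_, ?_⟩,
    Delaunay.isEmbeddedCMC_hypersurface hn3 hh hC.1 hσ.contDiff hI hsq hcount hper⟩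
  · rw [Delaunay.range_rotationalMap hA hb hAp hbp, Delaunay.hypersurface_eq]
  · intro θ x
    rw [Delaunay.rotationalMap_exp hA hb hAp hbp, Delaunay.spiralProduct, Delaunay.phaseCurve_eq]
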